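/- Let $N\in\mathbb N$ and let $J$ be a Lévy kernel on $\mathbb R^N$: $J\ge 0$ is measurable, $J(x,y)=J(y,x)$ for $x\ne y$, and $\sup_{x}\int_{\mathbb R^N}J(x,y)\min\{1,|x-y|^2\}\,dy<\infty$. Let $$\mathcal E(f,g)=\tfrac12\int_{\mathbb R^N}\int_{\mathbb R^N}(f(x)-f(y))(g(x)-g(y))J(x,y)\,dx\,dy,\qquad H_{\mathcal L}=\{f\in L^2(\mathbb R^N):\mathcal E(f,f)<\infty\},$$ and let $\mathcal L$ be the associated operator, $\langle\mathcal Lf,g\rangle=\mathcal E(f,g)$ for $f,g\in H_{\mathcal L}$. A (mild) solution with initial datum $u_0\in L^2(\mathbb R^N)$ is a function $u\in C([0,\infty);L^2)\cap C^1((0,\infty);L^2)\cap C((0,\infty);H_{\mathcal L})$ such that $u'(t)+\mathcal Lu(t)=0$ for $t>0$ and $u(0)=u_0$. Write $\mathrm{Ent}(f)=\int_{\mathbb R^N}|f|\log|f|-\left(\int_{\mathbb R^N}|f|\right)\log\left(\int_{\mathbb R^N}|f|\right)$, with $0\log 0=0$. Let $p\ge2$ and suppose that $\mathcal L$ is $p$-hypercontractive,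 that is, there are $t_\infty\in(0,\infty]$, a nondecreasing function $q:[0,t_\infty)\to[p,\infty)$ with $q(0)=p$ and $q(t)\to\infty$ as $t\to t_\infty$, and a function $A_p:[0,t_\infty)\to[0,\infty)$ such that $$\|u(t)\|_{q(t)}\le A_p(t)\,\|u_0\|_p\qquad\text{for all }0<t<t_\infty$$ for every solution $u$ with initial datum $u_0\in L^2(\mathbb R^N)\cap L^p(\mathbb R^N)$. Suppose moreover that $q$ is $C^1$ on $[0,t_\infty)$ with $q'(0)>0$, and that $$A_p(0)=\lim_{h\to0^+}A_p(h)=1,\qquad A_p'(0):=\lim_{h\to0^+}\frac{A_p(h)-1}{h}\ \text{ exists in }[-\infty,\infty)\text{ (in particular it may be finite)}.$$ Then, for every $f\in L^1(\mathbb R^N)\cap L^p(\mathbb R^N)\cap H_{\mathcal L}$, $$\mathrm{Ent}(|f|^p)\le C(p)\,\|f\|_p^p+D(p)\,\mathcal E(|f|^{p-2}f,f),\qquad C(p)=\frac{p^2A_p'(0)}{q'(0)},\qquad D(p)=\frac{p^2}{q'(0)}.$$ The inequality is understood in $[-\infty,\infty]$: the integrand of $\mathcal E(|f|^{p-2}f,f)$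 is nonnegative, and if its integral is infinite the right-hand side is $+\infty$ whenever $C(p)$ is finite; the convention $(-\infty)\cdot0=0$ is used for $f=0$, and a sum of $-\infty$ and $+\infty$ is read as $-\infty$. -/

import Mathlib

open MeasureTheory Filter Topology
open scoped ENNReal NNReal

noncomputable section

namespace LevyHyper

/-- `ℝ^N` with its Euclidean norm and Lebesgue measure. -/
abbrev RN (N : ℕ) : Type := EuclideanSpace ℝ (Fin N)

/-- The integral of a real function with values in `[-∞, ∞]`: the integral of the positive part
minus that of the negative part. It is the usual integral as soon as one of these is finite. -/
def extIntegral {α : Type*} [MeasurableSpace α] (μ : Measure α) (F : α → ℝ) : EReal :=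
  ((∫⁻ x, ENNReal.ofReal (F x) ∂μ : ℝ≥0∞) : EReal)
    - ((∫⁻ x, ENNReal.ofReal (-(F x)) ∂μ : ℝ≥0∞) : EReal)

/-- A (not necessarily translation invariant) Lévy kernel: measurable, nonnegative, symmetric off
the diagonal, with `sup_x ∫ J(x,y) min{1, |x-y|²} dy < ∞`. Its values on the diagonal play
no role. -/
structure IsLevyKernel {N : ℕ} (J : RN N → RN N → ℝ≥0) : Prop where
  measurable : Measurable (Function.uncurry J)
  symm : ∀ x y, x ≠ y → J x y = J y x
  levy : (⨆ x, ∫⁻ y, (J x y : ℝ≥0∞) * ENNReal.ofReal (min 1 (‖x - y‖ ^ 2))) < ∞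

/-- The Dirichlet form
`E(f,g) = ½ ∬ (f(x) - f(y)) (g(x) - g(y)) J(x,y) dx dy`, with values in `[-∞, ∞]`. -/
def dirichletForm {N : ℕ} (J : RN N → RN N → ℝ≥0) (f g : RN N → ℝ) : EReal :=
  extIntegral (volume.prod volume) fun z : RN N × RN N =>
    1 / 2 * ((f z.1 - f z.2) * (g z.1 - g z.2) * (J z.1 z.2 : ℝ))

/-- The Sobolev space `H_L = {f ∈ L² : E(f,f) < ∞}`. -/
def InHL {N : ℕ} (J : RN N → RN N → ℝ≥0) (f : RN N → ℝ) : Prop :=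
  MemLp f 2 volume ∧ dirichletForm J f f < ⊤

/-- `u` is a mild solution of `∂ₜu + Lu = 0`, `u(0) = u₀ ∈ L²`: it lies in
`C([0,∞); L²) ∩ C¹((0,∞); L²) ∩ C((0,∞); H_L)` and solves `du/dt + Lu = 0` in `(0,∞)`, where `L`
is understood via `⟨Lf, g⟩ = E(f,g)` for `f, g ∈ H_L`. The value of `u` at negative times plays no
role. -/
structure IsMildSolution {N : ℕ} (J : RN N → RN N → ℝ≥0)
    (u₀ : Lp ℝ 2 (volume : Measure (RN N))) (u : ℝ → Lp ℝ 2 (volume : Measure (RN N))) :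
    Prop where
  initial : u 0 = u₀
  continuousOn : ContinuousOn u (Set.Ici 0)
  contDiffOn : ContDiffOn ℝ 1 u (Set.Ioi 0)
  mem_HL : ∀ t, 0 < t → InHL J (u t)
  continuous_energy : ∀ t, 0 < t →
    Tendsto (fun s => dirichletForm J (u s - u t : Lp ℝ 2 (volume : Measure (RN N)))
      (u s - u t : Lp ℝ 2 (volume : Measure (RN N)))) (𝓝 t) (𝓝 0)
  equation : ∀ t, 0 < t → ∀ g : Lp ℝ 2 (volume : Measure (RN N)), InHL J g →
    dirichletForm J (u t) g = ((-(inner ℝ (deriv u t) g) : ℝ) : EReal)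

/-- The real times in `[0, T)`, for `T ∈ [-∞, ∞]`. -/
def timeDomain (T : EReal) : Set ℝ := {t | 0 ≤ t ∧ (t : EReal) < T}

/-- The operator with kernel `J` is `p`-hypercontractive with blow-up time `T ∈ (0, ∞]`,
exponents `q : [0, T) → [p, ∞)` (nondecreasing, `q(0) = p`, `q(t) → ∞` as `t → T`) and
coefficients `A ≥ 0`: solutions satisfy `‖u(t)‖_{q(t)} ≤ A(t) ‖u₀‖_p` for `0 < t < T`. -/
structure IsHypercontractive {N : ℕ} (J : RN N → RN N → ℝ≥0) (p : ℝ) (T : EReal)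
    (q A : ℝ → ℝ) : Prop where
  T_pos : 0 < T
  q_zero : q 0 = p
  q_mono : MonotoneOn q (timeDomain T)
  q_lim : ∀ M : ℝ, ∃ s ∈ timeDomain T, ∀ t ∈ timeDomain T, s ≤ t → M ≤ q t
  A_nonneg : ∀ t ∈ timeDomain T, 0 ≤ A t
  bound : ∀ u₀ : Lp ℝ 2 (volume : Measure (RN N)), MemLp u₀ (ENNReal.ofReal p) volume →
    ∀ u : ℝ → Lp ℝ 2 (volume : Measure (RN N)), IsMildSolution J u₀ u →
      ∀ t ∈ timeDomain T, 0 < t →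
        eLpNorm (u t) (ENNReal.ofReal (q t)) volume
          ≤ ENNReal.ofReal (A t) * eLpNorm u₀ (ENNReal.ofReal p) volume

/-- The function `Φ(s) = s log s`, with `Φ(0) = 0`. -/
def Phi (s : ℝ) : ℝ := s * Real.log s

/-- The entropy `Ent(f) = ∫ Φ(|f|) - Φ(∫ |f|)` of an integrable function `f`, with values in
`[-∞, ∞]`. -/
def entropy {N : ℕ} (f : RN N → ℝ) : EReal :=
  extIntegral volume (fun x => Phi |f x|) - ((Phi (∫ x, |f x|) : ℝ) : EReal)

end LevyHyper

end

noncomputable section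

namespace LevyHyper

/-! The inequality is the derivative at time `0` of the hypercontractive bound. Let `f` be bounded,
`S = ∫|f|^p > 0`, and let `u` be the solution starting from `f`. Instead of differentiating
`‖u(t)‖_{q(t)}`, which would require regularity of nonlinear functions of `u(t)`, pair `u(t)` with
the fixed function `g = |f|^(p-2) f`. Then `a(t) = ∫ u(t) g` satisfies `a(0) = S` and `a'(0) = -E(f,
g)`. Hölder's inequality and hypercontractivity give `a(t) ≤ A(t) B(t)` with `B(t) = ‖f‖_p
‖g‖_{q(t)'}`, `q(t)'` being the conjugate exponent. Here `B` depends on `f` alone, and `B(0) = S`.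
Hence the derivative of `a/B` at `0` is at most `A'(0)`. The derivative of `B` contains `S log S`
and `∫|f|^p log|f|`, which combine into the entropy after multiplication by `p²/q'(0)`. This is
`le_deriv_of_bounded`, with `hasDerivWithinAt_dual_norm` for `B`.

Solutions come from `exists_mildSolution`: on the complexified form space `V`, with embedding `S : V
→ L²`, the operator `S†S` is `(1 + L)⁻¹`, and continuous functional calculus turns it into
`exp(-tL)`. A datum in `V` has an orbit continuous in the form norm up to `t = 0`, which is what
gives `a'(0)`.

A general `f` is truncated at `±(n+1)`. Truncation does not increase `E(|f|^(p-2) f, f)`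
(`dirichletForm_truncate_le`), and the entropy passes to the limit by Fatou's lemma
(`extIntegral_le_of_tendsto`). -/

/-! ### Scalar estimates for the heat symbols. -/

/-- The function `r ↦ λ^k exp(-tλ)`, `λ = 1/r - 1`, which turns the resolvent `(1 + L)⁻¹` into
`L^k exp(-tL)`. -/
def heatSymbol (k : ℕ) (t r : ℝ) : ℝ :=
  if r ≤ 0 then 0 else (1 / r - 1) ^ k * Real.exp (-(t * (1 / r - 1)))

/-- Up to the factor `exp t` the symbol is a polynomial in `t/r` times `exp(-t/r)`, and the smooth
gluing function absorbs every polynomial in the inverse variable at `0`. -/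
lemma continuous_heatSymbol (k : ℕ) {t : ℝ} (ht : 0 < t) : Continuous (heatSymbol k t) := by
  have h := (expNegInvGlue.continuous_polynomial_eval_inv_mul
    ((Polynomial.C t⁻¹ * Polynomial.X - 1) ^ k)).comp (continuous_id.div_const t)
  have h2 := h.const_mul (Real.exp t)
  refine h2.congr fun r => ?_
  simp only [Function.comp, id, heatSymbol, expNegInvGlue]
  by_cases hr : r ≤ 0
  · have : r / t ≤ 0 := div_nonpos_of_nonpos_of_nonneg hr ht.le
    simp [hr, this]
  · have hr' : 0 < r := not_le.mp hr
    have : ¬ r / t ≤ 0 := not_le.mpr (by positivity)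
    simp only [this, hr, if_false]
    have h1 : (r / t)⁻¹ = t * (1 / r) := by field_simp
    have h2 : Real.exp (-(t * (1 / r - 1))) = Real.exp t * Real.exp (-(r / t)⁻¹) := by
      rw [← Real.exp_add, h1]; ring_nf
    rw [h2, h1]
    simp only [Polynomial.eval_pow, Polynomial.eval_sub, Polynomial.eval_mul, Polynomial.eval_C,
      Polynomial.eval_X, Polynomial.eval_one]
    have h3 : t⁻¹ * (t * (1 / r)) = 1 / r := by field_simp
    rw [h3]; ring

lemma heatSymbol_of_pos (k : ℕ) (t : ℝ) {r : ℝ} (hr : 0 < r) :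
    heatSymbol k t r = (1 / r - 1) ^ k * Real.exp (-(t * (1 / r - 1))) := by
  simp [heatSymbol, not_le.mpr hr]

/-- The factor `1 + exp(-x)` covers both signs of `x`: with `x = (s - t)λ`, multiplication by
`exp(-tλ)` yields `exp(-tλ) + exp(-sλ)`, and each term is controlled separately. -/
lemma abs_exp_neg_sub_one_le (x : ℝ) : |Real.exp (-x) - 1| ≤ |x| * (1 + Real.exp (-x)) := by
  have h1 := Real.add_one_le_exp (-x)
  have h2 := Real.add_one_le_exp x
  have h3 := Real.exp_pos (-x)
  have h4 : Real.exp x * Real.exp (-x) = 1 := by rw [← Real.exp_add]; simp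
  have h5 : (x + 1) * Real.exp (-x) ≤ 1 := by nlinarith
  rw [abs_le]
  rcases abs_cases x with ⟨h, h'⟩ | ⟨h, h'⟩ <;> rw [h] <;> constructor <;> nlinarith

lemma abs_exp_neg_sub_one_add_le (x : ℝ) :
    |Real.exp (-x) - 1 + x| ≤ x ^ 2 * (1 + Real.exp (-x)) := by
  have h1 := Real.add_one_le_exp (-x)
  have h2 := Real.add_one_le_exp x
  have h3 := Real.exp_pos (-x)
  have h4 : Real.exp x * Real.exp (-x) = 1 := by rw [← Real.exp_add]; simp
  have h5 : (x + 1) * Real.exp (-x) ≤ 1 := by nlinarith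
  have h6 := abs_exp_neg_sub_one_le x
  rw [abs_of_nonneg (by linarith)]
  have h7 : x * (1 - Real.exp (-x)) ≤ |x| * |Real.exp (-x) - 1| := by
    rw [← abs_mul]
    calc x * (1 - Real.exp (-x)) = -(x * (Real.exp (-x) - 1)) := by ring
      _ ≤ _ := neg_le_abs _
  have h8 : |x| * |Real.exp (-x) - 1| ≤ |x| * (|x| * (1 + Real.exp (-x))) :=
    mul_le_mul_of_nonneg_left h6 (abs_nonneg _)
  have h9 : |x| * |x| = x ^ 2 := by rw [← abs_mul, ← sq, abs_of_nonneg (sq_nonneg x)]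
  nlinarith

lemma sq_mul_exp_neg_le {a l t : ℝ} (ha : 0 < a) (hl : 0 ≤ l) (ht : a ≤ t) :
    l ^ 2 * Real.exp (-(t * l)) ≤ 2 / a ^ 2 := by
  have h1 : (a * l) ^ 2 / 2 ≤ Real.exp (t * l) := by
    have := Real.quadratic_le_exp_of_nonneg (x := t * l) (by nlinarith)
    have h2 : (a * l) ^ 2 ≤ (t * l) ^ 2 := by gcongr
    nlinarith [mul_nonneg (ha.le.trans ht) hl]
  have h4 : Real.exp (t * l) * Real.exp (-(t * l)) = 1 := by rw [← Real.exp_add]; simp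
  rw [le_div_iff₀ (by positivity)]
  have := mul_le_mul_of_nonneg_right h1 (Real.exp_pos (-(t * l))).le
  rw [h4] at this
  linarith

lemma abs_heatSymbol_sub_le {a s t r : ℝ} (ha : 0 < a) (hs : a ≤ s) (ht : a ≤ t) (hr : r ≤ 1) :
    |heatSymbol 1 s r - heatSymbol 1 t r| ≤ 4 / a ^ 2 * |s - t| := by
  rcases le_or_gt r 0 with h0 | h0
  · simp only [heatSymbol, h0, if_true, sub_self, abs_zero]; positivity
  rw [heatSymbol_of_pos _ _ h0, heatSymbol_of_pos _ _ h0]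
  have hl : 0 ≤ 1 / r - 1 := by rw [sub_nonneg, le_div_iff₀ h0]; linarith
  generalize 1 / r - 1 = l at hl ⊢
  have key := abs_exp_neg_sub_one_le ((s - t) * l)
  have e1 : l ^ 1 * Real.exp (-(s * l)) - l ^ 1 * Real.exp (-(t * l))
      = l * Real.exp (-(t * l)) * (Real.exp (-((s - t) * l)) - 1) := by
    rw [mul_sub, mul_assoc, ← Real.exp_add]; ring_nf
  have e2 : Real.exp (-(t * l)) * (1 + Real.exp (-((s - t) * l)))
      = Real.exp (-(t * l)) + Real.exp (-(s * l)) := by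
    rw [mul_add, ← Real.exp_add]; ring_nf
  rw [e1, abs_mul, abs_of_nonneg (by positivity)]
  calc l * Real.exp (-(t * l)) * |Real.exp (-((s - t) * l)) - 1|
      ≤ l * Real.exp (-(t * l)) * (|(s - t) * l| * (1 + Real.exp (-((s - t) * l)))) := by gcongr
    _ = |s - t| * (l ^ 2 * (Real.exp (-(t * l)) + Real.exp (-(s * l)))) := by
        rw [abs_mul, abs_of_nonneg hl, ← e2]; ring
    _ ≤ |s - t| * (2 / a ^ 2 + 2 / a ^ 2) := by
        rw [mul_add]
        gcongr
        · exact sq_mul_exp_neg_le ha hl ht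
        · exact sq_mul_exp_neg_le ha hl hs
    _ = _ := by ring

/-- A second-order Taylor remainder, uniform on the spectrum; it makes the orbit differentiable in
operator norm away from `t = 0`. -/
lemma abs_heatSymbol_sub_add_le {a s t r : ℝ} (ha : 0 < a) (hs : a ≤ s) (ht : a ≤ t)
    (hr : r ≤ 1) :
    |heatSymbol 0 s r - heatSymbol 0 t r + (s - t) * heatSymbol 1 t r|
      ≤ 4 / a ^ 2 * |s - t| ^ 2 := by
  rcases le_or_gt r 0 with h0 | h0
  · simp only [heatSymbol, h0, if_true, sub_self, mul_zero, add_zero, abs_zero]; positivity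
  simp only [heatSymbol_of_pos _ _ h0]
  have hl : 0 ≤ 1 / r - 1 := by rw [sub_nonneg, le_div_iff₀ h0]; linarith
  generalize 1 / r - 1 = l at hl ⊢
  have key := abs_exp_neg_sub_one_add_le ((s - t) * l)
  have e1 : l ^ 0 * Real.exp (-(s * l)) - l ^ 0 * Real.exp (-(t * l))
        + (s - t) * (l ^ 1 * Real.exp (-(t * l)))
      = Real.exp (-(t * l)) * (Real.exp (-((s - t) * l)) - 1 + (s - t) * l) := by
    rw [mul_add, mul_sub, ← Real.exp_add]; ring_nf
  have e2 : Real.exp (-(t * l)) * (1 + Real.exp (-((s - t) * l)))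
      = Real.exp (-(t * l)) + Real.exp (-(s * l)) := by
    rw [mul_add, ← Real.exp_add]; ring_nf
  rw [e1, abs_mul, abs_of_nonneg (Real.exp_pos _).le]
  calc Real.exp (-(t * l)) * |Real.exp (-((s - t) * l)) - 1 + (s - t) * l|
      ≤ Real.exp (-(t * l)) * (((s - t) * l) ^ 2 * (1 + Real.exp (-((s - t) * l)))) := by gcongr
    _ = |s - t| ^ 2 * (l ^ 2 * (Real.exp (-(t * l)) + Real.exp (-(s * l)))) := by
        rw [sq_abs, ← e2]; ring
    _ ≤ |s - t| ^ 2 * (2 / a ^ 2 + 2 / a ^ 2) := by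
        rw [mul_add]
        gcongr
        · exact sq_mul_exp_neg_le ha hl ht
        · exact sq_mul_exp_neg_le ha hl hs
    _ = _ := by ring

lemma abs_heatSymbol_zero_le {t r : ℝ} (ht : 0 ≤ t) (hr : r ≤ 1) : |heatSymbol 0 t r| ≤ 1 := by
  rcases le_or_gt r 0 with h0 | h0
  · simp [heatSymbol, h0]
  rw [heatSymbol_of_pos _ _ h0, pow_zero, one_mul, abs_of_nonneg (Real.exp_pos _).le,
    Real.exp_le_one_iff]
  have hl : 0 ≤ 1 / r - 1 := by rw [sub_nonneg, le_div_iff₀ h0]; linarith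
  have := mul_nonneg ht hl
  linarith

/-- Since `r λ = 1 - r ≤ 1`, one has `r (1 - exp(-tλ)) ≤ r t λ ≤ t`. This is the rate of convergence
at `t = 0` on the range of the resolvent. -/
lemma abs_heatSymbol_zero_mul_sub_le {t r : ℝ} (ht : 0 ≤ t) (hr0 : 0 ≤ r) (hr : r ≤ 1) :
    |heatSymbol 0 t r * r - r| ≤ t := by
  rcases hr0.eq_or_lt with h0 | h0
  · simp [← h0, ht]
  rw [heatSymbol_of_pos _ _ h0, pow_zero, one_mul]
  have hl : 0 ≤ 1 / r - 1 := by rw [sub_nonneg, le_div_iff₀ h0]; linarith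
  have h1 := Real.add_one_le_exp (-(t * (1 / r - 1)))
  have h2 : Real.exp (-(t * (1 / r - 1))) ≤ 1 := by
    rw [Real.exp_le_one_iff]; have := mul_nonneg ht hl; linarith
  have h3 : r * (t * (1 / r - 1)) = t * (1 - r) := by field_simp
  rw [abs_le]
  constructor <;> nlinarith

lemma one_sub_mul_heatSymbol_zero {r : ℝ} (t : ℝ) (hr0 : 0 ≤ r) :
    heatSymbol 0 t r - r * heatSymbol 0 t r = r * heatSymbol 1 t r := by
  rcases hr0.eq_or_lt with h0 | h0
  · simp [← h0, heatSymbol]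
  rw [heatSymbol_of_pos _ _ h0, heatSymbol_of_pos _ _ h0]
  field_simp

/-! ### The semigroup by functional calculus of the resolvent. -/

section Orbit

variable {V : Type*} [NormedAddCommGroup V] [InnerProductSpace ℂ V] [CompleteSpace V]

lemma spectrum_subset_Icc_of_isPositive {T : V →L[ℂ] V} (hT : T.IsPositive) (hT1 : ‖T‖ ≤ 1) :
    spectrum ℝ T ⊆ Set.Icc 0 1 := by
  intro r hr
  refine ⟨spectrum_nonneg_of_nonneg ((ContinuousLinearMap.nonneg_iff_isPositive T).mpr hT) hr, ?_⟩
  have h := spectrum.norm_le_norm_mul_of_mem hr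
  have h1 : ‖(1 : V →L[ℂ] V)‖ ≤ 1 := ContinuousLinearMap.norm_id_le
  calc r ≤ ‖r‖ := Real.le_norm_self r
    _ ≤ ‖T‖ * ‖(1 : V →L[ℂ] V)‖ := h
    _ ≤ 1 * 1 := by gcongr
    _ = 1 := one_mul 1

lemma dense_range_of_isPositive_of_injective {T : V →L[ℂ] V} (hT : T.IsPositive)
    (hinj : Function.Injective T) : DenseRange T := by
  have h : (T.range)ᗮ = ⊥ := by
    rw [ContinuousLinearMap.orthogonal_range, hT.isSelfAdjoint.adjoint_eq]
    exact LinearMap.ker_eq_bot.mpr hinj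
  have h2 := (Submodule.topologicalClosure_eq_top_iff (K := T.range)).mpr h
  have h3 := Submodule.dense_iff_topologicalClosure_eq_top.mpr h2
  exact h3

/-- The semigroup generated by `-L`, where `T = (1 + L)⁻¹` is an injective positive contraction. -/
theorem exists_semigroup_orbit (T : V →L[ℂ] V) (hT : T.IsPositive) (hT1 : ‖T‖ ≤ 1)
    (hinj : Function.Injective T) (f : V) :
    ∃ U W : ℝ → V, U 0 = f ∧ ContinuousOn U (Set.Ici 0) ∧
      (∀ t, 0 < t → HasDerivAt U (-(W t)) t) ∧ ContinuousOn W (Set.Ioi 0) ∧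
      ∀ t, 0 < t → U t - T (U t) = T (W t) := by
  have hsa : IsSelfAdjoint T := hT.isSelfAdjoint
  have hsp := spectrum_subset_Icc_of_isPositive hT hT1
  have hc : ∀ k {t : ℝ}, 0 < t → ContinuousOn (heatSymbol k t) (spectrum ℝ T) :=
    fun k t ht => (continuous_heatSymbol k ht).continuousOn
  set Φ : ℕ → ℝ → V →L[ℂ] V := fun k t => cfc (heatSymbol k t) T with hΦ
  -- At `t = 0` the symbol is the indicator of `(0, ∞)`, which may be discontinuous on the spectrum,
  -- so the initial value is prescribed separately.
  set U : ℝ → V := fun t => if t = 0 then f else Φ 0 t f with hU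
  set W : ℝ → V := fun t => Φ 1 t f with hW
  have hU' : ∀ t, 0 < t → U t = Φ 0 t f := fun t ht => by simp [hU, ht.ne']
  have hbd1 : ∀ {a s t : ℝ}, 0 < a → a ≤ s → a ≤ t →
      ‖Φ 1 s - Φ 1 t‖ ≤ 4 / a ^ 2 * |s - t| := by
    intro a s t ha hs ht
    simp only [hΦ]
    rw [← cfc_sub _ _ _ (hc 1 (ha.trans_le hs)) (hc 1 (ha.trans_le ht))]
    exact norm_cfc_le (by positivity) fun r hr => abs_heatSymbol_sub_le ha hs ht (hsp hr).2
  have hbd0 : ∀ {a s t : ℝ}, 0 < a → a ≤ s → a ≤ t →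
      ‖Φ 0 s - Φ 0 t + (s - t) • Φ 1 t‖ ≤ 4 / a ^ 2 * |s - t| ^ 2 := by
    intro a s t ha hs ht
    simp only [hΦ]
    have c0 := hc 0 (ha.trans_le hs)
    have c0' := hc 0 (ha.trans_le ht)
    have c1 := hc 1 (ha.trans_le ht)
    rw [← cfc_sub _ _ _ c0 c0', ← cfc_const_mul _ _ _ c1,
      ← cfc_add (a := T) (fun r => heatSymbol 0 s r - heatSymbol 0 t r)
        (fun r => (s - t) * heatSymbol 1 t r) (c0.sub c0') (c1.const_mul _)]
    exact norm_cfc_le (by positivity) fun r hr => abs_heatSymbol_sub_add_le ha hs ht (hsp hr).2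
  have hder : ∀ t, 0 < t → HasDerivAt U (-(W t)) t := by
    intro t ht
    have ha : 0 < t / 2 := by positivity
    rw [hasDerivAt_iff_isLittleO]
    have hO : (fun s => U s - U t - (s - t) • (-(W t))) =O[𝓝 t] fun s => |s - t| ^ 2 := by
      refine Asymptotics.IsBigO.of_bound (4 / (t / 2) ^ 2 * ‖f‖) ?_
      filter_upwards [lt_mem_nhds (half_lt_self ht)] with s hs
      have e : U s - U t - (s - t) • (-(W t)) = (Φ 0 s - Φ 0 t + (s - t) • Φ 1 t) f := by
        rw [hU' s (ha.trans hs), hU' t ht]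
        simp [hW]
      rw [e]
      calc _ ≤ ‖Φ 0 s - Φ 0 t + (s - t) • Φ 1 t‖ * ‖f‖ := ContinuousLinearMap.le_opNorm _ _
        _ ≤ 4 / (t / 2) ^ 2 * |s - t| ^ 2 * ‖f‖ := by
            gcongr; exact hbd0 ha hs.le (half_lt_self ht).le
        _ = _ := by rw [Real.norm_of_nonneg (by positivity)]; ring
    refine hO.trans_isLittleO ?_
    have h1 : (fun s : ℝ => |s - t| ^ 2) = fun s => (s - t) * (s - t) := by
      ext s; rw [sq_abs, sq]
    rw [h1]
    have h2 : (fun s : ℝ => s - t) =o[𝓝 t] fun _ => (1 : ℝ) := by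
      rw [Asymptotics.isLittleO_one_iff]
      have : Tendsto (fun s : ℝ => s - t) (𝓝 t) (𝓝 (t - t)) := tendsto_id.sub_const t
      simpa using this
    simpa using h2.mul_isBigO (Asymptotics.isBigO_refl (fun s : ℝ => s - t) (𝓝 t))
  have hle1 : ∀ t, 0 < t → ‖Φ 0 t‖ ≤ 1 := fun t ht =>
    norm_cfc_le zero_le_one fun r hr => abs_heatSymbol_zero_le ht.le (hsp hr).2
  have hlet : ∀ t, 0 < t → ‖Φ 0 t * T - T‖ ≤ t := by
    intro t ht
    have e : Φ 0 t * T - T = cfc (fun r => heatSymbol 0 t r * r - r) T := by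
      rw [cfc_sub (a := T) (fun r => heatSymbol 0 t r * r) (fun r => r)
        ((hc 0 ht).mul continuousOn_id) continuousOn_id,
        cfc_mul (a := T) _ (fun r => r) (hc 0 ht) continuousOn_id, cfc_id' ℝ T]
    rw [e]
    exact norm_cfc_le ht.le fun r hr =>
      abs_heatSymbol_zero_mul_sub_le ht.le (hsp hr).1 (hsp hr).2
  have hU0 : U 0 = f := by simp [hU]
  refine ⟨U, W, hU0, ?_, hder, ?_, ?_⟩
  · intro t ht
    rcases (Set.mem_Ici.mp ht).eq_or_lt with h0 | h0
    · subst h0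
      -- Strong continuity at `0`: `f` is approximated by some `T w`, where convergence has the rate
      -- `t ‖w‖`; the error is controlled by contractivity.
      have hdense := dense_range_of_isPositive_of_injective hT hinj
      rw [ContinuousWithinAt, hU0, Metric.tendsto_nhdsWithin_nhds]
      intro ε hε
      obtain ⟨w, hw⟩ := hdense.exists_dist_lt f (show 0 < ε / 3 by positivity)
      refine ⟨ε / (3 * (‖w‖ + 1)), by positivity, fun {s} hs hsd => ?_⟩
      rcases (Set.mem_Ici.mp hs).eq_or_lt with hs0 | hs0
      · rw [← hs0, hU0]; simpa using hε
      rw [hU' s hs0, dist_eq_norm]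
      have e : Φ 0 s f - f = Φ 0 s (f - T w) + (Φ 0 s * T - T) w - (f - T w) := by
        simp
      have b1 : ‖f - T w‖ < ε / 3 := by rwa [← dist_eq_norm]
      have b2 : ‖Φ 0 s (f - T w)‖ ≤ 1 * ‖f - T w‖ :=
        (Φ 0 s).le_of_opNorm_le (hle1 s hs0) _
      have b3 : ‖(Φ 0 s * T - T) w‖ ≤ s * ‖w‖ :=
        ContinuousLinearMap.le_of_opNorm_le _ (hlet s hs0) _
      have b4 : s * ‖w‖ ≤ ε / 3 := by
        rw [Real.dist_eq, sub_zero, abs_of_pos hs0, lt_div_iff₀ (by positivity)] at hsd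
        nlinarith [norm_nonneg w]
      rw [e]
      calc _ ≤ ‖Φ 0 s (f - T w) + (Φ 0 s * T - T) w‖ + ‖f - T w‖ := norm_sub_le _ _
        _ ≤ ‖Φ 0 s (f - T w)‖ + ‖(Φ 0 s * T - T) w‖ + ‖f - T w‖ := by
            gcongr; exact norm_add_le _ _
        _ < ε := by linarith
    · exact (hder t h0).continuousAt.continuousWithinAt
  · intro t ht
    have ht : 0 < t := ht
    have ha : 0 < t / 2 := by positivity
    refine ContinuousAt.continuousWithinAt ?_
    rw [ContinuousAt, tendsto_iff_norm_sub_tendsto_zero]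
    have hlim : Tendsto (fun s => 4 / (t / 2) ^ 2 * |s - t| * ‖f‖) (𝓝 t) (𝓝 0) := by
      have : Continuous (fun s => 4 / (t / 2) ^ 2 * |s - t| * ‖f‖) := by fun_prop
      simpa using this.tendsto t
    refine squeeze_zero' (Eventually.of_forall fun _ => norm_nonneg _) ?_ hlim
    filter_upwards [lt_mem_nhds (half_lt_self ht)] with s hs
    calc ‖W s - W t‖ = ‖(Φ 1 s - Φ 1 t) f‖ := by simp [hW]
      _ ≤ _ := ContinuousLinearMap.le_of_opNorm_le _ (hbd1 ha hs.le (half_lt_self ht).le) _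
  · intro t ht
    -- The resolvent form of `W = L U`: on the spectrum, `1 - r = r λ`.
    have e : Φ 0 t - T * Φ 0 t = T * Φ 1 t := by
      have h1 : T * Φ 0 t = cfc (fun r => r * heatSymbol 0 t r) T := by
        rw [cfc_mul (a := T) (fun r => r) _ continuousOn_id (hc 0 ht), cfc_id' ℝ T]
      have h2 : T * Φ 1 t = cfc (fun r => r * heatSymbol 1 t r) T := by
        rw [cfc_mul (a := T) (fun r => r) _ continuousOn_id (hc 1 ht), cfc_id' ℝ T]
      rw [h1, h2, ← cfc_sub (a := T) _ (fun r => r * heatSymbol 0 t r) (hc 0 ht)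
        (continuousOn_id.mul (hc 0 ht))]
      exact cfc_congr fun r hr => one_sub_mul_heatSymbol_zero t (hsp hr).1
    rw [hU' t ht]
    simpa using congrArg (fun S : V →L[ℂ] V => S f) e

end Orbit

/-! ### The Dirichlet form as an `L²` pairing of increments. -/

lemma extIntegral_of_integrable {α : Type*} [MeasurableSpace α] {μ : Measure α} {F : α → ℝ}
    (hF : Integrable F μ) : extIntegral μ F = ((∫ x, F x ∂μ : ℝ) : EReal) := by
  have h1 : (∫⁻ x, ENNReal.ofReal (F x) ∂μ) ≠ ∞ := hF.lintegral_lt_top.ne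
  have h2 : (∫⁻ x, ENNReal.ofReal (-(F x)) ∂μ) ≠ ∞ := hF.neg.lintegral_lt_top.ne
  rw [extIntegral, integral_eq_lintegral_pos_part_sub_lintegral_neg_part hF, EReal.coe_sub,
    EReal.coe_ennreal_toReal h1, EReal.coe_ennreal_toReal h2]

lemma extIntegral_of_nonneg {α : Type*} [MeasurableSpace α] {μ : Measure α} {F : α → ℝ}
    (hF : ∀ x, 0 ≤ F x) :
    extIntegral μ F = ((∫⁻ x, ENNReal.ofReal (F x) ∂μ : ℝ≥0∞) : EReal) := by
  have h : ∀ x, ENNReal.ofReal (-(F x)) = 0 := fun x =>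
    ENNReal.ofReal_of_nonpos (neg_nonpos.mpr (hF x))
  simp [extIntegral, h]

variable {N : ℕ} {J : RN N → RN N → ℝ≥0}

/-- The measure `½ J(x,y) dx dy` of the jumps. -/
def jumpMeasure (J : RN N → RN N → ℝ≥0) : Measure (RN N × RN N) :=
  (volume.prod volume).withDensity fun z => ((J z.1 z.2 / 2 : ℝ≥0) : ℝ≥0∞)

/-- The increments `g(x) - g(y)`. -/
def diff {E : Type*} [Sub E] (g : RN N → E) (z : RN N × RN N) : E := g z.1 - g z.2

lemma jumpMeasure_ac : jumpMeasure J ≪ (volume : Measure (RN N)).prod volume :=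
  withDensity_absolutelyContinuous _ _

lemma ae_jumpMeasure_of_ae {P : RN N → Prop} (h : ∀ᵐ x, P x) :
    ∀ᵐ z ∂jumpMeasure J, P z.1 ∧ P z.2 :=
  jumpMeasure_ac.ae_le ((Measure.quasiMeasurePreserving_fst.ae h).and
    (Measure.quasiMeasurePreserving_snd.ae h))

lemma diff_congr {E : Type*} [Sub E] {g g' : RN N → E} (h : g =ᵐ[volume] g') :
    diff g =ᵐ[jumpMeasure J] diff g' := by
  filter_upwards [ae_jumpMeasure_of_ae h] with z hz
  simp [diff, hz.1, hz.2]

lemma aestronglyMeasurable_diff_prod {E : Type*} [NormedAddCommGroup E] {g : RN N → E}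
    (hg : AEStronglyMeasurable g volume) :
    AEStronglyMeasurable (diff g) ((volume : Measure (RN N)).prod volume) :=
  (hg.comp_quasiMeasurePreserving Measure.quasiMeasurePreserving_fst).sub
    (hg.comp_quasiMeasurePreserving Measure.quasiMeasurePreserving_snd)

lemma aestronglyMeasurable_diff {E : Type*} [NormedAddCommGroup E] {g : RN N → E}
    (hg : AEStronglyMeasurable g volume) :
    AEStronglyMeasurable (diff g) (jumpMeasure J) :=
  (aestronglyMeasurable_diff_prod hg).mono_ac jumpMeasure_ac

lemma IsLevyKernel.measurable_density (hJ : IsLevyKernel J) :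
    Measurable fun z : RN N × RN N => J z.1 z.2 / 2 :=
  hJ.measurable.div_const 2

lemma dirichletForm_integrand_eq (f g : RN N → ℝ) (z : RN N × RN N) :
    1 / 2 * ((f z.1 - f z.2) * (g z.1 - g z.2) * (J z.1 z.2 : ℝ))
      = (J z.1 z.2 / 2 : ℝ≥0) • (diff f z * diff g z) := by
  rw [NNReal.smul_def, smul_eq_mul, diff, diff]
  push_cast
  ring

lemma dirichletForm_eq_of_integrable (hJ : IsLevyKernel J) {f g : RN N → ℝ}
    (h : Integrable (fun z => diff f z * diff g z) (jumpMeasure J)) :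
    dirichletForm J f g = ((∫ z, diff f z * diff g z ∂jumpMeasure J : ℝ) : EReal) := by
  have h1 := (integrable_withDensity_iff_integrable_smul hJ.measurable_density).mp h
  rw [dirichletForm]
  simp_rw [dirichletForm_integrand_eq]
  rw [extIntegral_of_integrable h1, jumpMeasure,
    integral_withDensity_eq_integral_smul hJ.measurable_density]

lemma dirichletForm_eq_integral (hJ : IsLevyKernel J) {f g : RN N → ℝ}
    (hf : MemLp (diff f) 2 (jumpMeasure J)) (hg : MemLp (diff g) 2 (jumpMeasure J)) :
    dirichletForm J f g = ((∫ z, diff f z * diff g z ∂jumpMeasure J : ℝ) : EReal) :=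
  dirichletForm_eq_of_integrable hJ (hf.integrable_mul hg)

/-- The integrand of `E(f, f)` is nonnegative, so finiteness of the energy is exactly square
integrability of the increments for the jump measure. -/
lemma inHL_iff (hJ : IsLevyKernel J) {f : RN N → ℝ} :
    InHL J f ↔ MemLp f 2 volume ∧ MemLp (diff f) 2 (jumpMeasure J) := by
  refine and_congr_right fun hf => ⟨fun h => ?_, fun h => ?_⟩
  · have hF : ∀ z : RN N × RN N,
        0 ≤ 1 / 2 * ((f z.1 - f z.2) * (f z.1 - f z.2) * (J z.1 z.2 : ℝ)) := fun z =>
      mul_nonneg (by norm_num) (mul_nonneg (mul_self_nonneg _) (J z.1 z.2).2)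
    rw [memLp_two_iff_integrable_sq (aestronglyMeasurable_diff hf.1)]
    simp_rw [sq]
    refine (integrable_withDensity_iff_integrable_smul hJ.measurable_density).mpr ?_
    simp_rw [← dirichletForm_integrand_eq]
    have hd := aestronglyMeasurable_diff_prod hf.1
    refine ⟨?_, ?_⟩
    · exact ((hd.mul hd).mul
        hJ.measurable.coe_nnreal_real.aestronglyMeasurable).const_mul (1 / 2)
    · rw [hasFiniteIntegral_iff_ofReal (Eventually.of_forall hF)]
      rw [dirichletForm, extIntegral_of_nonneg hF] at h
      rwa [← EReal.coe_ennreal_top, EReal.coe_ennreal_lt_coe_ennreal_iff] at h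
  · rw [dirichletForm_eq_integral hJ h h]
    exact EReal.coe_lt_top _

/-! ### The form space and existence of mild solutions. -/

/-- The space `H_L` of complex valued functions, with the inner product `⟨f, g⟩ + E(f, g)`,
as a subspace of the Hilbert space of pairs `(f, D)` in which `D(x, y) = f(x) - f(y)`. -/
def formSpace (J : RN N → RN N → ℝ≥0) :
    Submodule ℂ (WithLp 2 (Lp ℂ 2 (volume : Measure (RN N)) × Lp ℂ 2 (jumpMeasure J))) where
  carrier := {v | v.snd =ᵐ[jumpMeasure J] diff v.fst}
  zero_mem' := by
    simp only [Set.mem_ofPred_eq, WithLp.zero_fst, WithLp.zero_snd]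
    filter_upwards [Lp.coeFn_zero ℂ 2 (jumpMeasure J),
      diff_congr (J := J) (Lp.coeFn_zero ℂ 2 (volume : Measure (RN N)))] with z h1 h2
    rw [h1, h2]
    simp [diff]
  add_mem' := by
    intro a b ha hb
    simp only [Set.mem_ofPred_eq, WithLp.add_fst, WithLp.add_snd] at *
    filter_upwards [ha, hb, Lp.coeFn_add a.snd b.snd,
      diff_congr (J := J) (Lp.coeFn_add a.fst b.fst)] with z h1 h2 h3 h4
    rw [h3, h4, Pi.add_apply, h1, h2]
    simp only [diff, Pi.add_apply]
    ring
  smul_mem' := by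
    intro c a ha
    simp only [Set.mem_ofPred_eq, WithLp.smul_fst, WithLp.smul_snd] at *
    filter_upwards [ha, Lp.coeFn_smul c a.snd,
      diff_congr (J := J) (Lp.coeFn_smul c a.fst)] with z h1 h2 h3
    rw [h2, h3, Pi.smul_apply, h1]
    simp only [diff, Pi.smul_apply, smul_eq_mul]
    ring

/-- Closedness of the form: `L²` limits are almost everywhere limits along a subsequence, and the
pointwise relation between function and increments survives them. -/
lemma isClosed_formSpace : IsClosed (formSpace J : Set (WithLp 2
    (Lp ℂ 2 (volume : Measure (RN N)) × Lp ℂ 2 (jumpMeasure J)))) := by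
  refine IsSeqClosed.isClosed fun v w hv hlim => ?_
  have h1 : Tendsto (fun n => (v n).fst) atTop (𝓝 w.fst) :=
    ((WithLp.continuous_fst 2 _ _).tendsto w).comp hlim
  have h2 : Tendsto (fun n => (v n).snd) atTop (𝓝 w.snd) :=
    ((WithLp.continuous_snd 2 _ _).tendsto w).comp hlim
  obtain ⟨ns, hns, hae1⟩ := (tendstoInMeasure_of_tendsto_Lp h1).exists_seq_tendsto_ae
  -- Extracted from the first subsequence, so that both components converge along the same indices.
  obtain ⟨ms, hms, hae2⟩ :=
    (tendstoInMeasure_of_tendsto_Lp (h2.comp hns.tendsto_atTop)).exists_seq_tendsto_ae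
  have hall : ∀ᵐ z ∂jumpMeasure J, ∀ n, (v n).snd z = diff (v n).fst z :=
    ae_all_iff.mpr fun n => hv n
  change w.snd =ᵐ[jumpMeasure J] diff w.fst
  filter_upwards [ae_jumpMeasure_of_ae hae1, hae2, hall] with z h3 h4 h5
  refine tendsto_nhds_unique h4 ?_
  have h6 := (h3.1.sub h3.2).comp hms.tendsto_atTop
  refine h6.congr fun n => ?_
  simp [h5, diff]

instance : CompleteSpace (formSpace J) := isClosed_formSpace.completeSpace_coe

/-- The embedding of the form space into `L²`. -/
def formSpaceFst (J : RN N → RN N → ℝ≥0) :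
    formSpace J →L[ℂ] Lp ℂ 2 (volume : Measure (RN N)) :=
  (WithLp.fstL 2 ℂ _ _).comp (formSpace J).subtypeL

lemma formSpaceFst_apply (v : formSpace J) :
    formSpaceFst J v = (v : WithLp 2 (Lp ℂ 2 (volume : Measure (RN N)) ×
      Lp ℂ 2 (jumpMeasure J))).fst := rfl

lemma norm_formSpaceFst_le : ‖formSpaceFst J‖ ≤ 1 := by
  refine ContinuousLinearMap.opNorm_le_bound _ zero_le_one fun v => ?_
  rw [one_mul, formSpaceFst_apply]
  exact WithLp.norm_fst_le _ _

lemma formSpaceFst_injective : Function.Injective (formSpaceFst J) := by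
  rw [injective_iff_map_eq_zero]
  intro v hv
  have h1 := v.2
  change v.1.snd =ᵐ[jumpMeasure J] diff v.1.fst at h1
  rw [formSpaceFst_apply] at hv
  rw [hv] at h1
  have h2 : v.1.snd = 0 := by
    rw [Lp.eq_zero_iff_ae_eq_zero]
    refine h1.trans ?_
    filter_upwards [diff_congr (J := J) (Lp.coeFn_zero ℂ 2 (volume : Measure (RN N)))] with z h
    rw [h]; simp [diff]
  refine Subtype.ext ?_
  apply WithLp.ofLp_injective
  exact Prod.ext hv h2

/-- The real part on complex `L²`. -/
def reLp {α : Type*} [MeasurableSpace α] (μ : Measure α) : Lp ℂ 2 μ →L[ℝ] Lp ℝ 2 μ :=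
  Complex.reCLM.compLpL 2 μ

lemma coeFn_reLp {α : Type*} [MeasurableSpace α] {μ : Measure α} (a : Lp ℂ 2 μ) :
    reLp μ a =ᵐ[μ] fun x => (a x).re :=
  ContinuousLinearMap.coeFn_compLpL Complex.reCLM a

lemma re_inner_toLp_ofReal {α : Type*} [MeasurableSpace α] {μ : Measure α} (a : Lp ℂ 2 μ)
    {b : α → ℝ} (hb : MemLp b 2 μ) :
    (inner ℂ a (hb.ofReal (K := ℂ)).toLp).re = ∫ x, (a x).re * b x ∂μ := by
  rw [L2.inner_def, ← Complex.reCLM_apply,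
    ← ContinuousLinearMap.integral_comp_comm _ (L2.integrable_inner _ _)]
  refine integral_congr_ae ?_
  filter_upwards [(hb.ofReal (K := ℂ)).coeFn_toLp] with x hx
  rw [hx]
  simp [mul_comm]

/-- A real function of `H_L` as an element of the form space. -/
def toFormSpace {f : RN N → ℝ} (hf : MemLp f 2 volume) (hd : MemLp (diff f) 2 (jumpMeasure J)) :
    formSpace J :=
  ⟨WithLp.toLp 2 ((hf.ofReal (K := ℂ)).toLp, (hd.ofReal (K := ℂ)).toLp), by
    change (hd.ofReal (K := ℂ)).toLp =ᵐ[jumpMeasure J] diff (hf.ofReal (K := ℂ)).toLp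
    filter_upwards [(hd.ofReal (K := ℂ)).coeFn_toLp,
      diff_congr (J := J) (hf.ofReal (K := ℂ)).coeFn_toLp] with z h1 h2
    rw [h1, h2]
    simp [diff]⟩

lemma diff_reLp (v : formSpace J) :
    diff (reLp volume (formSpaceFst J v)) =ᵐ[jumpMeasure J] fun z => (v.1.snd z).re := by
  have h1 := v.2
  change v.1.snd =ᵐ[jumpMeasure J] diff v.1.fst at h1
  filter_upwards [h1, diff_congr (J := J) (coeFn_reLp (formSpaceFst J v))] with z h2 h3
  rw [h2, h3, formSpaceFst_apply]
  simp [diff]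

lemma memLp_diff_reLp (v : formSpace J) :
    MemLp (diff (reLp volume (formSpaceFst J v))) 2 (jumpMeasure J) :=
  MemLp.ae_eq (diff_reLp v).symm (Lp.memLp v.1.snd).re

lemma inHL_reLp (hJ : IsLevyKernel J) (v : formSpace J) :
    InHL J (reLp volume (formSpaceFst J v)) :=
  (inHL_iff hJ).mpr ⟨Lp.memLp _, memLp_diff_reLp v⟩

lemma dirichletForm_nonneg (f : RN N → ℝ) : 0 ≤ dirichletForm J f f := by
  have hF : ∀ z : RN N × RN N,
      0 ≤ 1 / 2 * ((f z.1 - f z.2) * (f z.1 - f z.2) * (J z.1 z.2 : ℝ)) := fun z =>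
    mul_nonneg (by norm_num) (mul_nonneg (mul_self_nonneg _) (J z.1 z.2).2)
  rw [dirichletForm, extIntegral_of_nonneg hF]
  exact EReal.coe_ennreal_nonneg _

lemma dirichletForm_reLp_le (hJ : IsLevyKernel J) (v : formSpace J) :
    dirichletForm J (reLp volume (formSpaceFst J v)) (reLp volume (formSpaceFst J v))
      ≤ ((‖v‖ ^ 2 : ℝ) : EReal) := by
  rw [dirichletForm_eq_integral hJ (memLp_diff_reLp v) (memLp_diff_reLp v), EReal.coe_le_coe_iff]
  have h1 : ‖v.1.snd‖ ^ 2 = ∫ z, ‖v.1.snd z‖ ^ 2 ∂jumpMeasure J := by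
    rw [← inner_self_eq_norm_sq (𝕜 := ℂ), L2.inner_def, RCLike.re_eq_complex_re,
      ← Complex.reCLM_apply,
      ← ContinuousLinearMap.integral_comp_comm _ (L2.integrable_inner _ _)]
    refine integral_congr_ae (Eventually.of_forall fun z => ?_)
    simp only [Complex.reCLM_apply]
    rw [← RCLike.re_eq_complex_re, inner_self_eq_norm_sq]
  have h2 : ‖v.1.snd‖ ^ 2 ≤ ‖v‖ ^ 2 := by
    have : ‖v‖ ^ 2 = ‖v.1.fst‖ ^ 2 + ‖v.1.snd‖ ^ 2 := WithLp.prod_norm_sq_eq_of_L2 v.1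
    rw [this]; nlinarith [sq_nonneg ‖v.1.fst‖]
  refine le_trans ?_ h2
  rw [h1]
  refine integral_mono_ae ((memLp_diff_reLp v).integrable_mul (memLp_diff_reLp v))
    ((Lp.memLp v.1.snd).integrable_norm_pow two_ne_zero) ?_
  filter_upwards [diff_reLp v] with z hz
  rw [hz]
  have := Complex.abs_re_le_norm (v.1.snd z)
  calc _ = |(v.1.snd z).re| ^ 2 := by rw [sq_abs, sq]
    _ ≤ _ := by gcongr

lemma inner_toLp_eq_integral {α : Type*} [MeasurableSpace α] {μ : Measure α} (a : Lp ℝ 2 μ)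
    {b : α → ℝ} (hb : MemLp b 2 μ) : inner ℝ a hb.toLp = ∫ x, a x * b x ∂μ := by
  rw [L2.inner_def]
  refine integral_congr_ae ?_
  filter_upwards [hb.coeFn_toLp] with x hx
  rw [hx]
  simp [mul_comm]

/-- The semigroup of the form `⟨v, w⟩ - ⟨S v, S w⟩` on `V`, seen through a real-linear map `R`
on `H`. -/
theorem exists_form_orbit {V H K : Type*} [NormedAddCommGroup V]
    [InnerProductSpace ℂ V] [CompleteSpace V] [NormedAddCommGroup H] [InnerProductSpace ℂ H]
    [CompleteSpace H] [NormedAddCommGroup K] [NormedSpace ℝ K] (S : V →L[ℂ] H) (hS : ‖S‖ ≤ 1)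
    (hinj : Function.Injective S) (R : H →+ K) (hR : Continuous R) (f : V) :
    ∃ U W : ℝ → V, U 0 = f ∧ (∀ t, 0 < t → Tendsto (fun s => ‖U s - U t‖ ^ 2) (𝓝 t) (𝓝 0)) ∧
      ContinuousOn (fun t => R (S (U t))) (Set.Ici 0) ∧
      ContDiffOn ℝ 1 (fun t => R (S (U t))) (Set.Ioi 0) ∧
      (∀ t, 0 < t → deriv (fun t => R (S (U t))) t = -(R (S (W t)))) ∧
      (∀ t, 0 < t → ∀ v, inner ℂ (U t) v - inner ℂ (S (U t)) (S v) = inner ℂ (S (W t)) (S v)) ∧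
      ∀ (ℓ : K →L[ℝ] ℝ) (b : V → ℝ), Continuous b → (∀ t, 0 < t → b (U t) = ℓ (R (S (W t)))) →
        HasDerivWithinAt (fun t => ℓ (R (S (U t)))) (-(b f)) (Set.Ici 0) 0 := by
  -- `⟨S†S w, v⟩_V = ⟨S w, S v⟩_H`, so `S†S` is the resolvent `(1 + L)⁻¹` acting on `V`.
  obtain ⟨U, W, hU0, hUc, hUd, hWc, hUW⟩ := exists_semigroup_orbit (S.adjoint ∘SL S)
    (ContinuousLinearMap.isPositive_adjoint_comp_self S)
    (by
      rw [ContinuousLinearMap.norm_adjoint_comp_self]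
      exact mul_le_one₀ hS (norm_nonneg _) hS)
    ((ContinuousLinearMap.adjoint_comp_self_injective_iff S).mpr hinj) f
  set Q : V →L[ℝ] K := (R.toRealLinearMap hR).comp (S.restrictScalars ℝ) with hQ
  have hder : ∀ t, 0 < t → HasDerivAt (fun s => R (S (U s))) (-(R (S (W t)))) t := fun t ht => by
    have := Q.hasFDerivAt.comp_hasDerivAt t (hUd t ht)
    rw [map_neg] at this
    exact this
  refine ⟨U, W, hU0, fun t ht => ?_, Q.continuous.comp_continuousOn hUc, ?_,
    fun t ht => (hder t ht).deriv, fun t ht v => ?_, fun ℓ b hb hbW => ?_⟩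
  · have h2 : Tendsto (fun s => ‖U s - U t‖ ^ 2) (𝓝 t) (𝓝 (‖U t - U t‖ ^ 2)) :=
      (((hUd t ht).continuousAt.tendsto).sub_const (U t)).norm.pow 2
    rwa [sub_self, norm_zero, zero_pow two_ne_zero] at h2
  · rw [show (1 : WithTop ℕ∞) = 0 + 1 by simp, contDiffOn_succ_iff_deriv_of_isOpen isOpen_Ioi]
    refine ⟨fun t ht => (hder t ht).differentiableAt.differentiableWithinAt, by simp, ?_⟩
    rw [contDiffOn_zero]
    exact (Q.continuous.comp_continuousOn hWc).neg.congr fun t ht => (hder t ht).deriv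
  · have h3 := congrArg (fun w => inner ℂ w v) (hUW t ht)
    simpa only [inner_sub_left, ContinuousLinearMap.comp_apply,
      ContinuousLinearMap.adjoint_inner_left] using h3
  · have hder' : ∀ t, 0 < t → HasDerivAt (fun s => ℓ (R (S (U s)))) (-(ℓ (R (S (W t))))) t :=
      fun t ht => by
        have := ℓ.hasFDerivAt.comp_hasDerivAt t (hder t ht)
        rw [map_neg] at this
        exact this
    -- The derivative at `0` is the limit of the derivatives at `t > 0`. These are `-b(U t)`, and `U
    -- t → f` in the norm of `V`, where `b` is continuous.
    refine hasDerivWithinAt_Ici_of_tendsto_deriv (s := Set.Ioi 0)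
      (fun t ht => (hder' t ht).differentiableAt.differentiableWithinAt) ?_
      self_mem_nhdsWithin ?_
    · exact ((ℓ.continuous.comp Q.continuous).comp_continuousOn hUc 0
        Set.self_mem_Ici).mono Set.Ioi_subset_Ici_self
    · have hU1 : Tendsto U (𝓝[>] 0) (𝓝 (U 0)) :=
        (hUc 0 Set.self_mem_Ici).mono Set.Ioi_subset_Ici_self
      rw [← hU0]
      refine ((hb.tendsto (U 0)).comp hU1).neg.congr' ?_
      filter_upwards [self_mem_nhdsWithin] with t ht
      rw [(hder' t ht).deriv, ← hbW t ht]
      rfl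

lemma formSpace_inner (v w : formSpace J) :
    inner ℂ v w = inner ℂ (formSpaceFst J v) (formSpaceFst J w)
      + inner ℂ v.1.snd w.1.snd := by
  rw [Submodule.coe_inner]
  exact WithLp.prod_inner_apply _ _

lemma toFormSpace_snd {f : RN N → ℝ} (hf : MemLp f 2 volume)
    (hd : MemLp (diff f) 2 (jumpMeasure J)) :
    (toFormSpace hf hd).1.snd = (hd.ofReal (K := ℂ)).toLp := rfl

lemma formSpaceFst_toFormSpace {f : RN N → ℝ} (hf : MemLp f 2 volume)
    (hd : MemLp (diff f) 2 (jumpMeasure J)) :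
    formSpaceFst J (toFormSpace hf hd) = (hf.ofReal (K := ℂ)).toLp := rfl

lemma integral_diff_reLp_mul (v : formSpace J) {g : RN N → ℝ}
    (hd : MemLp (diff g) 2 (jumpMeasure J)) :
    ∫ z, diff (reLp volume (formSpaceFst J v)) z * diff g z ∂jumpMeasure J
      = (inner ℂ v.1.snd (hd.ofReal (K := ℂ)).toLp).re := by
  rw [re_inner_toLp_ofReal _ hd]
  refine integral_congr_ae ?_
  filter_upwards [diff_reLp v] with z hz
  rw [hz]

/-- The weak formulation of the equation, tested against a real function of `H_L`. -/
lemma integral_diff_eq_of_inner_eq (U W : formSpace J)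
    (h : ∀ v : formSpace J, inner ℂ U v - inner ℂ (formSpaceFst J U) (formSpaceFst J v)
      = inner ℂ (formSpaceFst J W) (formSpaceFst J v))
    {g : RN N → ℝ} (hg : MemLp g 2 volume) (hd : MemLp (diff g) 2 (jumpMeasure J)) :
    ∫ z, diff (reLp volume (formSpaceFst J U)) z * diff g z ∂jumpMeasure J
      = ∫ x, reLp volume (formSpaceFst J W) x * g x := by
  have h2 : ∫ x, reLp volume (formSpaceFst J W) x * g x
      = (inner ℂ (formSpaceFst J W) (hg.ofReal (K := ℂ)).toLp).re := by
    rw [re_inner_toLp_ofReal _ hg]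
    refine integral_congr_ae ?_
    filter_upwards [coeFn_reLp (formSpaceFst J W)] with z hz
    rw [hz]
  have h3 := h (toFormSpace hg hd)
  rw [formSpace_inner, add_sub_cancel_left, toFormSpace_snd, formSpaceFst_toFormSpace] at h3
  rw [integral_diff_reLp_mul U hd, h2, h3]

lemma reLp_formSpaceFst_toFormSpace {f : RN N → ℝ} (hf : MemLp f 2 volume)
    (hd : MemLp (diff f) 2 (jumpMeasure J)) :
    reLp volume (formSpaceFst J (toFormSpace hf hd)) = hf.toLp := by
  refine Lp.ext ?_
  filter_upwards [coeFn_reLp (formSpaceFst J (toFormSpace hf hd)), hf.coeFn_toLp,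
    (hf.ofReal (K := ℂ)).coeFn_toLp] with x h1 h2 h3
  rw [h1, h2, formSpaceFst_toFormSpace, h3]
  rfl

lemma reLp_formSpaceFst_sub (v w : formSpace J) :
    reLp volume (formSpaceFst J v) - reLp volume (formSpaceFst J w)
      = reLp volume (formSpaceFst J (v - w)) :=
  ((reLp volume).map_sub (formSpaceFst J v) (formSpaceFst J w)).symm

theorem exists_mildSolution (hJ : IsLevyKernel J) {f : RN N → ℝ} (hf : MemLp f 2 volume)
    (hdf : MemLp (diff f) 2 (jumpMeasure J)) :
    ∃ u : ℝ → Lp ℝ 2 (volume : Measure (RN N)), IsMildSolution J hf.toLp u ∧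
      ∀ g : RN N → ℝ, MemLp g 2 volume → MemLp (diff g) 2 (jumpMeasure J) →
        HasDerivWithinAt (fun t => ∫ x, u t x * g x)
          (-∫ z, diff f z * diff g z ∂jumpMeasure J) (Set.Ici 0) 0 := by
  obtain ⟨U, W, hU0, hUlim, hUc, hC1, hderiv, hUW, hweak⟩ := exists_form_orbit (formSpaceFst J)
    norm_formSpaceFst_le formSpaceFst_injective (reLp volume).toLinearMap.toAddMonoidHom
    (reLp volume).continuous (toFormSpace hf hdf)
  change ContinuousOn (fun t => reLp volume (formSpaceFst J (U t))) (Set.Ici 0) at hUc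
  change ContDiffOn ℝ 1 (fun t => reLp volume (formSpaceFst J (U t))) (Set.Ioi 0) at hC1
  change ∀ t, 0 < t → deriv (fun t => reLp volume (formSpaceFst J (U t))) t
    = -(reLp volume (formSpaceFst J (W t))) at hderiv
  have hwk : ∀ t, 0 < t → ∀ g : RN N → ℝ, MemLp g 2 volume →
      MemLp (diff g) 2 (jumpMeasure J) →
      ∫ z, diff (reLp volume (formSpaceFst J (U t))) z * diff g z ∂jumpMeasure J
        = ∫ x, reLp volume (formSpaceFst J (W t)) x * g x :=
    fun t ht g hg hd => integral_diff_eq_of_inner_eq (U t) (W t) (hUW t ht) hg hd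
  refine ⟨fun t => reLp volume (formSpaceFst J (U t)), ⟨?_, hUc, hC1, ?_, ?_, ?_⟩, ?_⟩
  · rw [hU0, reLp_formSpaceFst_toFormSpace]
  · exact fun t _ => inHL_reLp hJ (U t)
  · intro t ht
    have h1 : Tendsto (fun s => ((‖U s - U t‖ ^ 2 : ℝ) : EReal)) (𝓝 t) (𝓝 0) :=
      (continuous_coe_real_ereal.tendsto (0 : ℝ)).comp (hUlim t ht)
    have hsub : ∀ s, reLp volume (formSpaceFst J (U s)) - reLp volume (formSpaceFst J (U t))
        = reLp volume (formSpaceFst J (U s - U t)) := fun s => reLp_formSpaceFst_sub _ _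
    simp only [hsub]
    have hlow : ∀ s, 0 ≤ dirichletForm J (reLp volume (formSpaceFst J (U s - U t)))
        (reLp volume (formSpaceFst J (U s - U t))) := fun s => dirichletForm_nonneg _
    exact tendsto_of_tendsto_of_tendsto_of_le_of_le tendsto_const_nhds h1 hlow
      fun s => dirichletForm_reLp_le hJ (U s - U t)
  · intro t ht g hg
    have hg' := (inHL_iff hJ).mp hg
    rw [dirichletForm_eq_integral hJ (memLp_diff_reLp (U t)) hg'.2, EReal.coe_eq_coe_iff,
      hderiv t ht, inner_neg_left, neg_neg, hwk t ht g hg'.1 hg'.2,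
      ← inner_toLp_eq_integral _ hg'.1, Lp.toLp_coeFn]
  · intro g hg hd
    have hℓa : ∀ a, innerSL ℝ hg.toLp a = ∫ x, a x * g x := fun a => by
      rw [innerSL_apply_apply, real_inner_comm, inner_toLp_eq_integral]
    have hb : ∀ t, 0 < t → (inner ℂ (U t).1.snd (hd.ofReal (K := ℂ)).toLp).re
        = innerSL ℝ hg.toLp (reLp volume (formSpaceFst J (W t))) := fun t ht => by
      rw [hℓa]
      exact (integral_diff_reLp_mul (U t) hd).symm.trans (hwk t ht g hg hd)
    have key := hweak (innerSL ℝ hg.toLp)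
      (fun v => (inner ℂ v.1.snd (hd.ofReal (K := ℂ)).toLp).re)
      (Complex.continuous_re.comp (((WithLp.continuous_snd 2 _ _).comp
            continuous_subtype_val).inner continuous_const))
      hb
    simp_rw [hℓa] at key
    have hval : (inner ℂ (toFormSpace hf hdf).1.snd (hd.ofReal (K := ℂ)).toLp).re
        = ∫ z, diff f z * diff g z ∂jumpMeasure J := by
      rw [← integral_diff_reLp_mul _ hd, reLp_formSpaceFst_toFormSpace]
      refine integral_congr_ae ?_
      filter_upwards [diff_congr (J := J) hf.coeFn_toLp] with z hz
      rw [hz]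
    rw [hval] at key
    exact key

/-! ### The odd power function and elementary inequalities. -/

/-- The odd power `s ↦ |s|^(p-2) s`. -/
def oddPow (p s : ℝ) : ℝ := |s| ^ (p - 2) * s

lemma oddPow_neg (p s : ℝ) : oddPow p (-s) = -oddPow p s := by simp [oddPow]

lemma oddPow_of_nonneg {p s : ℝ} (hp : 2 ≤ p) (hs : 0 ≤ s) : oddPow p s = s ^ (p - 1) := by
  rw [oddPow, abs_of_nonneg hs]
  nth_rewrite 2 [← Real.rpow_one s]
  rw [← Real.rpow_add_of_nonneg hs (by linarith) zero_le_one]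
  ring_nf

lemma abs_oddPow {p : ℝ} (hp : 2 ≤ p) (s : ℝ) : |oddPow p s| = |s| ^ (p - 1) := by
  rw [← oddPow_of_nonneg hp (abs_nonneg s), oddPow, oddPow, abs_mul,
    abs_of_nonneg (by positivity), abs_abs]

lemma mul_oddPow {p : ℝ} (hp : 2 ≤ p) (s : ℝ) : s * oddPow p s = |s| ^ p := by
  have h : |s| ^ (2 : ℝ) = s ^ 2 := by rw [Real.rpow_two, sq_abs]
  rw [oddPow, show s * (|s| ^ (p - 2) * s) = |s| ^ (p - 2) * s ^ 2 by ring, ← h,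
    ← Real.rpow_add_of_nonneg (abs_nonneg s) (by linarith) zero_le_two]
  ring_nf

lemma monotone_oddPow {p : ℝ} (hp : 2 ≤ p) : Monotone (oddPow p) := by
  refine monotone_of_odd_of_monotoneOn_nonneg (oddPow_neg p) fun a ha b hb hab => ?_
  rw [oddPow_of_nonneg hp ha, oddPow_of_nonneg hp hb]
  exact Real.rpow_le_rpow ha hab (by linarith)

lemma measurable_oddPow (p : ℝ) : Measurable (oddPow p) := by
  unfold oddPow
  fun_prop

/-- A Lipschitz bound on `[-K, K]`, which makes `|f|^(p-2) f` an admissible test function when `f`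
is bounded. For equal signs it is the mean value inequality; for opposite signs the two bounds
against `0` add up. -/
lemma abs_oddPow_sub_le {p K a b : ℝ} (hp : 2 ≤ p) (ha : |a| ≤ K) (hb : |b| ≤ K) :
    |oddPow p a - oddPow p b| ≤ (p - 1) * K ^ (p - 2) * |a - b| := by
  have hnn : ∀ x ∈ Set.Icc 0 K, ∀ y ∈ Set.Icc 0 K,
      |oddPow p y - oddPow p x| ≤ (p - 1) * K ^ (p - 2) * |y - x| := by
    intro x hx y hy
    rw [oddPow_of_nonneg hp hx.1, oddPow_of_nonneg hp hy.1]
    refine Convex.norm_image_sub_le_of_norm_hasDerivWithin_le (s := Set.Icc 0 K)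
      (f := fun z : ℝ => z ^ (p - 1)) (f' := fun z : ℝ => (p - 1) * z ^ (p - 1 - 1))
      (fun z _ => (Real.hasDerivAt_rpow_const (Or.inr (by linarith))).hasDerivWithinAt)
      (fun z hz => ?_) (convex_Icc 0 K) hx hy
    rw [Real.norm_of_nonneg (mul_nonneg (by linarith) (Real.rpow_nonneg hz.1 _)),
      show p - 1 - 1 = p - 2 by ring]
    exact mul_le_mul_of_nonneg_left (Real.rpow_le_rpow hz.1 hz.2 (by linarith)) (by linarith)
  have hK : 0 ≤ K := (abs_nonneg a).trans ha
  have h0 : oddPow p 0 = 0 := by simp [oddPow]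
  have hmix : ∀ x ∈ Set.Icc 0 K, ∀ y ∈ Set.Icc 0 K,
      |oddPow p x + oddPow p y| ≤ (p - 1) * K ^ (p - 2) * |x + y| := by
    intro x hx y hy
    have h1 := hnn 0 ⟨le_rfl, hK⟩ x hx
    have h2 := hnn 0 ⟨le_rfl, hK⟩ y hy
    rw [h0, sub_zero, sub_zero] at h1 h2
    have h3 := abs_add_le (oddPow p x) (oddPow p y)
    rw [abs_of_nonneg hx.1] at h1
    rw [abs_of_nonneg hy.1] at h2
    rw [abs_of_nonneg (add_nonneg hx.1 hy.1), mul_add]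
    linarith
  rw [abs_le] at ha hb
  rcases le_total 0 a with h1 | h1 <;> rcases le_total 0 b with h2 | h2
  · exact hnn b ⟨h2, hb.2⟩ a ⟨h1, ha.2⟩
  · have := hmix a ⟨h1, ha.2⟩ (-b) ⟨by linarith, by linarith⟩
    simpa only [oddPow_neg, ← sub_eq_add_neg] using this
  · have := hmix (-a) ⟨by linarith, by linarith⟩ b ⟨h2, hb.2⟩
    rw [oddPow_neg, ← abs_neg, ← abs_neg (-a + b)] at this
    convert this using 2 <;> [skip; congr 1] <;> ring_nf
  · have := hnn (-a) ⟨by linarith, by linarith⟩ (-b) ⟨by linarith, by linarith⟩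
    rw [oddPow_neg, oddPow_neg] at this
    convert this using 2 <;> [skip; congr 1] <;> ring_nf

/-- A bound uniform in the exponent and linear in `a`, hence integrable for `f ∈ L¹`. Below `1`, a
factor `√a` is spared to absorb the logarithm, whence `3/2`; above `1`, `log a ≤ a ≤ K`. -/
lemma rpow_mul_abs_log_le {a K r P : ℝ} (ha : 0 ≤ a) (haK : a ≤ K) (hr : 3 / 2 ≤ r)
    (hrP : r ≤ P) : a ^ r * |Real.log a| ≤ (2 + K ^ P) * a := by
  have hK : 0 ≤ K := ha.trans haK
  rcases ha.eq_or_lt with h0 | h0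
  · rw [← h0, Real.zero_rpow (by linarith)]; simp
  rcases le_total a 1 with h1 | h1
  · have h2 := Real.abs_log_mul_self_rpow_lt a (1 / 2) h0 h1 (by norm_num)
    rw [abs_mul, abs_of_nonneg (Real.rpow_nonneg ha (1 / 2))] at h2
    have h3 : a ^ r ≤ a * a ^ (1 / 2 : ℝ) := by
      calc a ^ r ≤ a ^ (1 + 1 / 2 : ℝ) :=
            Real.rpow_le_rpow_of_exponent_ge h0 h1 (by linarith)
        _ = _ := by rw [Real.rpow_add h0, Real.rpow_one]
    calc a ^ r * |Real.log a| ≤ a * a ^ (1 / 2 : ℝ) * |Real.log a| := by gcongr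
      _ = a * (|Real.log a| * a ^ (1 / 2 : ℝ)) := by ring
      _ ≤ a * 2 := by gcongr; linarith
      _ ≤ _ := by nlinarith [mul_nonneg (Real.rpow_nonneg hK P) ha]
  · have hl : |Real.log a| ≤ a := by
      rw [abs_of_nonneg (Real.log_nonneg h1)]
      linarith [Real.log_le_sub_one_of_pos h0]
    have h3 : a ^ (r - 1) ≤ K ^ (P - 1) :=
      (Real.rpow_le_rpow_of_exponent_le h1 (by linarith)).trans
        (Real.rpow_le_rpow ha haK (by linarith))
    have hK0 : 0 < K := by linarith
    calc a ^ r * |Real.log a| = a * a ^ (r - 1) * |Real.log a| := by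
          rw [Real.rpow_sub_one h0.ne']; field_simp
      _ ≤ a * K ^ (P - 1) * K := by gcongr; exact hl.trans haK
      _ = K ^ P * a := by rw [Real.rpow_sub_one hK0.ne']; field_simp
      _ ≤ _ := by linarith

/-! ### Moments of bounded functions and the dual norm. -/

section Integral

variable {α : Type*} [MeasurableSpace α] {μ : Measure α} {f : α → ℝ} {K : ℝ}

lemma integrable_abs_rpow_of_bounded (hf : Integrable f μ) (hK : ∀ x, |f x| ≤ K) {r : ℝ}
    (hr : 1 ≤ r) : Integrable (fun x => |f x| ^ r) μ := by
  refine (hf.abs.const_mul (K ^ (r - 1))).mono'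
    (hf.1.aemeasurable.abs.pow_const r).aestronglyMeasurable
    (Eventually.of_forall fun x => ?_)
  rw [Real.norm_of_nonneg (by positivity)]
  have h : |f x| ^ r = |f x| ^ (r - 1) * |f x| := by
    nth_rewrite 3 [← Real.rpow_one |f x|]
    rw [← Real.rpow_add_of_nonneg (abs_nonneg _) (by linarith) zero_le_one]
    ring_nf
  rw [h]
  exact mul_le_mul_of_nonneg_right (Real.rpow_le_rpow (abs_nonneg _) (hK x) (by linarith))
    (abs_nonneg _)

lemma integrable_abs_rpow_mul_log_of_bounded (hf : Integrable f μ) (hK : ∀ x, |f x| ≤ K)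
    {r : ℝ} (hr : 3 / 2 ≤ r) : Integrable (fun x => |f x| ^ r * Real.log |f x|) μ := by
  refine (hf.abs.const_mul (2 + K ^ r)).mono'
    ((hf.1.aemeasurable.abs.pow_const r).mul
      (Real.measurable_log.comp_aemeasurable hf.1.aemeasurable.abs)).aestronglyMeasurable
    (Eventually.of_forall fun x => ?_)
  rw [norm_mul, Real.norm_of_nonneg (Real.rpow_nonneg (abs_nonneg _) _)]
  exact rpow_mul_abs_log_le (abs_nonneg _) (hK x) hr le_rfl

lemma hasDerivAt_integral_abs_rpow (hf : Integrable f μ) (hK : ∀ x, |f x| ≤ K) {p : ℝ}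
    (hp : 2 ≤ p) :
    HasDerivAt (fun r : ℝ => ∫ x, |f x| ^ r ∂μ) (∫ x, |f x| ^ p * Real.log |f x| ∂μ) p := by
  refine (hasDerivAt_integral_of_dominated_loc_of_deriv_le (μ := μ)
    (F := fun (r : ℝ) x => |f x| ^ r) (F' := fun (r : ℝ) x => |f x| ^ r * Real.log |f x|)
    (bound := fun x => (2 + K ^ (p + 1)) * |f x|)
    -- As `p ≥ 2`, exponents in this window exceed `3/2`, as the dominating bound requires.
    (Ioo_mem_nhds (show p - 1 / 2 < p by linarith) (show p < p + 1 by linarith))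
    (Eventually.of_forall fun r => (hf.1.aemeasurable.abs.pow_const r).aestronglyMeasurable)
    (integrable_abs_rpow_of_bounded hf hK (by linarith))
    (integrable_abs_rpow_mul_log_of_bounded hf hK (by linarith)).1
    (Eventually.of_forall fun x r hr => ?_) ?_ (Eventually.of_forall fun x r hr => ?_)).2
  · rw [norm_mul, Real.norm_of_nonneg (Real.rpow_nonneg (abs_nonneg _) _)]
    exact rpow_mul_abs_log_le (abs_nonneg _) (hK x) (by linarith [hr.1]) hr.2.le
  · exact hf.abs.const_mul _
  · rcases (abs_nonneg (f x)).eq_or_lt with h0 | h0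
    · rw [← h0, Real.log_zero, mul_zero]
      refine (hasDerivAt_const r (0 : ℝ)).congr_of_eventuallyEq ?_
      filter_upwards [lt_mem_nhds (show 0 < r by linarith [hr.1])] with s hs
      exact Real.zero_rpow hs.ne'
    · exact (Real.hasStrictDerivAt_const_rpow h0 r).hasDerivAt

end Integral

lemma integral_mul_le_of_eLpNorm_le {α : Type*} [MeasurableSpace α] {μ : Measure α}
    {u g : α → ℝ} {s C : ℝ} (hs : 1 < s) (hC : 0 ≤ C) (hu : AEStronglyMeasurable u μ)
    (huC : eLpNorm u (ENNReal.ofReal s) μ ≤ ENNReal.ofReal C)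
    (hg : MemLp g (ENNReal.ofReal (s / (s - 1))) μ) :
    ∫ x, u x * g x ∂μ ≤ C * (∫ x, |g x| ^ (s / (s - 1)) ∂μ) ^ (1 - 1 / s) := by
  have hs0 : 0 < s := by linarith
  have hconj : s.HolderConjugate (s / (s - 1)) := Real.HolderConjugate.conjExponent hs
  have hum : MemLp u (ENNReal.ofReal s) μ := ⟨hu, huC.trans_lt ENNReal.ofReal_lt_top⟩
  rw [hum.eLpNorm_eq_integral_rpow_norm (by simpa using hs0) ENNReal.ofReal_ne_top,
    ENNReal.toReal_ofReal hs0.le, ENNReal.ofReal_le_ofReal_iff hC] at huC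
  have h1 := integral_mul_norm_le_Lp_mul_Lq hconj hum hg
  have h2 : ∫ x, u x * g x ∂μ ≤ ∫ x, ‖u x‖ * ‖g x‖ ∂μ := by
    have := norm_integral_le_integral_norm (μ := μ) (fun x => u x * g x)
    simp_rw [norm_mul] at this
    exact (Real.le_norm_self _).trans this
  have h3 : 1 / (s / (s - 1)) = 1 - 1 / s := by field_simp
  rw [one_div, h3] at h1
  refine h2.trans (h1.trans ?_)
  exact mul_le_mul_of_nonneg_right huC
    (Real.rpow_nonneg (integral_nonneg fun x => Real.rpow_nonneg (norm_nonneg _) _) _)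

/-- The derivative at `0` of `h ↦ ‖f‖_p ‖|f|^(p-1)‖_{q(h)'}`. -/
lemma hasDerivWithinAt_dual_norm {p d S Lam : ℝ} {q m : ℝ → ℝ} (hp : 2 ≤ p) (hS : 0 < S)
    (hq0 : q 0 = p) (hq : HasDerivWithinAt q d (Set.Ici 0) 0) (hmS : m p = S)
    (hm : HasDerivAt m Lam p) :
    HasDerivWithinAt (fun t => Real.exp (1 / p * Real.log S
        + (1 - 1 / q t) * Real.log (m ((p - 1) * (q t / (q t - 1))))))
      (d / p ^ 2 * S * Real.log S - d / p * Lam) (Set.Ici 0) 0 := by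
  have hp0 : p ≠ 0 := by linarith
  have hp1 : p - 1 ≠ 0 := by linarith
  have hr0 : (p - 1) * (q 0 / (q 0 - 1)) = p := by rw [hq0]; field_simp
  have h1 : HasDerivWithinAt (fun t => 1 - 1 / q t) (d / p ^ 2) (Set.Ici 0) 0 := by
    have := ((hasDerivWithinAt_const 0 (Set.Ici 0) (1 : ℝ)).fun_div hq
      (by rw [hq0]; exact hp0)).const_sub 1
    refine this.congr_deriv ?_
    rw [hq0]; ring
  -- Since `|f|^(p-1)` is raised to the power `q'`, the moment exponent is `(p-1) q/(q-1)`. It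
  -- equals `p` at `t = 0`.
  have h2 : HasDerivWithinAt (fun t => (p - 1) * (q t / (q t - 1))) (-(d / (p - 1)))
      (Set.Ici 0) 0 := by
    have := (hq.fun_div (hq.sub_const 1) (by rw [hq0]; exact hp1)).const_mul (p - 1)
    refine this.congr_deriv ?_
    rw [hq0]; field_simp; ring
  have h3 : HasDerivWithinAt (fun t => m ((p - 1) * (q t / (q t - 1)))) (Lam * -(d / (p - 1)))
      (Set.Ici 0) 0 := by
    rw [← hr0] at hm
    exact hm.comp_hasDerivWithinAt 0 h2
  have h4 := h3.log (by rw [hr0, hmS]; exact hS.ne')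
  have h5 := ((h1.fun_mul h4).const_add (1 / p * Real.log S)).exp
  refine h5.congr_deriv ?_
  rw [hr0, hmS, hq0]
  have h6 : 1 / p * Real.log S + (1 - 1 / p) * Real.log S = Real.log S := by ring
  rw [h6, Real.exp_log hS]
  field_simp
  ring

lemma memLp_of_bounded {α : Type*} [MeasurableSpace α] {μ : Measure α} {f : α → ℝ} {K r : ℝ}
    (hf : Integrable f μ) (hK : ∀ x, |f x| ≤ K) (hr : 1 ≤ r) :
    MemLp f (ENNReal.ofReal r) μ := by
  have hr0 : 0 < r := by linarith
  rw [← integrable_norm_rpow_iff hf.1 (by simpa using hr0) ENNReal.ofReal_ne_top,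
    ENNReal.toReal_ofReal hr0.le]
  exact integrable_abs_rpow_of_bounded hf hK hr

lemma memLp_oddPow {f : RN N → ℝ} {p K : ℝ} (hp : 2 ≤ p) (hf : MemLp f 2 volume)
    (hK : ∀ x, |f x| ≤ K) : MemLp (fun x => oddPow p (f x)) 2 volume := by
  refine hf.of_le_mul (c := K ^ (p - 2))
    ((measurable_oddPow p).comp_aemeasurable hf.1.aemeasurable).aestronglyMeasurable
    (Eventually.of_forall fun x => ?_)
  rw [Real.norm_eq_abs, oddPow, abs_mul, abs_of_nonneg (by positivity)]
  exact mul_le_mul_of_nonneg_right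
    (Real.rpow_le_rpow (abs_nonneg _) (hK x) (by linarith)) (abs_nonneg _)

lemma memLp_diff_oddPow {f : RN N → ℝ} {p K : ℝ} (hp : 2 ≤ p)
    (hfm : AEStronglyMeasurable f volume) (hf : MemLp (diff f) 2 (jumpMeasure J))
    (hK : ∀ x, |f x| ≤ K) : MemLp (diff fun x => oddPow p (f x)) 2 (jumpMeasure J) :=
  hf.of_le_mul (aestronglyMeasurable_diff
    ((measurable_oddPow p).comp_aemeasurable hfm.aemeasurable).aestronglyMeasurable)
    (Eventually.of_forall fun z => abs_oddPow_sub_le hp (hK z.1) (hK z.2))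

/-! ### Differentiating the bound at time zero. -/

lemma eventually_mem_timeDomain {T : EReal} (hT : 0 < T) :
    ∀ᶠ t : ℝ in 𝓝[>] 0, 0 < t ∧ t ∈ timeDomain T := by
  have h : ∀ᶠ t : ℝ in 𝓝 0, (t : EReal) < T :=
    (continuous_coe_real_ereal.tendsto (0 : ℝ)).eventually (Iio_mem_nhds hT)
  filter_upwards [self_mem_nhdsWithin, nhdsWithin_le_nhds h] with t h1 h2
  exact ⟨h1, (Set.mem_Ioi.mp h1).le, h2⟩

/-- Differentiating the hypercontractive bound at time `0`. -/
theorem le_deriv_of_bounded (hJ : IsLevyKernel J) {p : ℝ} (hp : 2 ≤ p) {T : EReal} {q A : ℝ → ℝ}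
    (hyper : IsHypercontractive J p T q A) (hq' : 0 < derivWithin q (Set.Ici 0) 0) {A' : EReal}
    (hA' : Tendsto (fun h : ℝ => (((A h - 1) / h : ℝ) : EReal)) (𝓝[>] 0) (𝓝 A'))
    {f : RN N → ℝ} {K : ℝ} (hK : ∀ x, |f x| ≤ K) (hf1 : Integrable f) (hf : MemLp f 2 volume)
    (hdf : MemLp (diff f) 2 (jumpMeasure J)) {S : ℝ} (hS : ∫ x, |f x| ^ p = S) (hS0 : 0 < S) :
    (((-∫ z, diff f z * diff (fun x => oddPow p (f x)) z ∂jumpMeasure J) / S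
      - (derivWithin q (Set.Ici 0) 0 / p ^ 2 * S * Real.log S
          - derivWithin q (Set.Ici 0) 0 / p * ∫ x, |f x| ^ p * Real.log |f x|) / S : ℝ) : EReal)
      ≤ A' := by
  set d := derivWithin q (Set.Ici 0) 0 with hd
  have hp0 : 0 < p := by linarith
  -- A nonzero `derivWithin` is a genuine derivative, since the default value is `0`.
  have hqd : HasDerivWithinAt q d (Set.Ici 0) 0 :=
    (differentiableWithinAt_of_derivWithin_ne_zero hq'.ne').hasDerivWithinAt
  obtain ⟨u, hu, huder⟩ := exists_mildSolution hJ hf hdf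
  have hader := huder _ (memLp_oddPow hp hf hK) (memLp_diff_oddPow hp hf.1 hdf hK)
  set E := ∫ z, diff f z * diff (fun x => oddPow p (f x)) z ∂jumpMeasure J with hE
  set a : ℝ → ℝ := fun t => ∫ x, u t x * oddPow p (f x) with ha
  set m : ℝ → ℝ := fun r => ∫ x, |f x| ^ r with hm
  set Lam := ∫ x, |f x| ^ p * Real.log |f x| with hLam
  have hmder : HasDerivAt m Lam p := hasDerivAt_integral_abs_rpow hf1 hK hp
  have hBder := hasDerivWithinAt_dual_norm hp hS0 hyper.q_zero hqd hS hmder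
  set B : ℝ → ℝ := fun t => Real.exp (1 / p * Real.log S
        + (1 - 1 / q t) * Real.log (m ((p - 1) * (q t / (q t - 1))))) with hB
  have hr0 : (p - 1) * (q 0 / (q 0 - 1)) = p := by
    have : p - 1 ≠ 0 := by linarith
    rw [hyper.q_zero]; field_simp
  have hB0 : B 0 = S := by
    simp only [hB]
    rw [hr0, hyper.q_zero, show m p = S from hS, show 1 / p * Real.log S + (1 - 1 / p) * Real.log S = Real.log S
      by ring, Real.exp_log hS0]
  have ha0 : a 0 = S := by
    simp only [ha]
    rw [hu.initial, ← hS]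
    refine integral_congr_ae ?_
    filter_upwards [hf.coeFn_toLp] with x hx
    rw [hx, mul_oddPow hp]
  have hquot : HasDerivWithinAt (fun t => a t / B t)
      (-E / S - (d / p ^ 2 * S * Real.log S - d / p * Lam) / S) (Set.Ici 0) 0 := by
    refine (hader.fun_div hBder (Real.exp_pos _).ne').congr_deriv ?_
    change (-E * B 0 - a 0 * _) / B 0 ^ 2 = _
    rw [hB0, ha0]
    field_simp
  have hslope : Tendsto (fun t => (a t / B t - 1) / t) (𝓝[>] 0)
      (𝓝 (-E / S - (d / p ^ 2 * S * Real.log S - d / p * Lam) / S)) := by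
    have := (hasDerivWithinAt_iff_tendsto_slope' Set.self_notMem_Ioi).mp hquot.Ioi_of_Ici
    refine this.congr fun t => ?_
    rw [slope_def_field, ha0, hB0, div_self hS0.ne', sub_zero]
  have hmpos : ∀ᶠ t in 𝓝[>] (0 : ℝ), 0 < m ((p - 1) * (q t / (q t - 1))) := by
    have hc : ContinuousWithinAt (fun t => m ((p - 1) * (q t / (q t - 1)))) (Set.Ici 0) 0 := by
      have h1 : ContinuousWithinAt (fun t => (p - 1) * (q t / (q t - 1))) (Set.Ici 0) 0 :=
        continuousWithinAt_const.mul (hqd.continuousWithinAt.div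
          (hqd.continuousWithinAt.sub continuousWithinAt_const)
          (by rw [hyper.q_zero]; linarith))
      have h2 : ContinuousAt m ((p - 1) * (q 0 / (q 0 - 1))) := by
        rw [hr0]; exact hmder.continuousAt
      exact ContinuousAt.comp_continuousWithinAt (f := fun t => (p - 1) * (q t / (q t - 1))) h2 h1
    refine (hc.mono Set.Ioi_subset_Ici_self).eventually (lt_mem_nhds ?_)
    change 0 < m ((p - 1) * (q 0 / (q 0 - 1)))
    rw [hr0, show m p = S from hS]
    exact hS0
  -- From `a(t) ≤ A(t) B(t)` one gets `(a(t)/B(t) - 1)/t ≤ (A(t) - 1)/t`; both sides have limits as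
  -- `t → 0+`.
  refine le_of_tendsto_of_tendsto ((continuous_coe_real_ereal.tendsto _).comp hslope) hA' ?_
  filter_upwards [eventually_mem_timeDomain hyper.T_pos, hmpos] with t ht hmt
  obtain ⟨ht0, htT⟩ := ht
  refine EReal.coe_le_coe_iff.mpr (div_le_div_of_nonneg_right (sub_le_sub_right ?_ 1) ht0.le)
  rw [div_le_iff₀ (Real.exp_pos _)]
  have hqp : p ≤ q t := by
    rw [← hyper.q_zero]
    exact hyper.q_mono ⟨le_rfl, hyper.T_pos⟩ htT ht0.le
  have hq1 : 0 < q t - 1 := by linarith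
  have hfp : MemLp f (ENNReal.ofReal p) volume := memLp_of_bounded hf1 hK (by linarith)
  have hnorm : eLpNorm hf.toLp (ENNReal.ofReal p) volume = ENNReal.ofReal (S ^ p⁻¹) := by
    rw [eLpNorm_congr_ae hf.coeFn_toLp, hfp.eLpNorm_eq_integral_rpow_norm
      (by simpa using hp0) ENNReal.ofReal_ne_top, ENNReal.toReal_ofReal hp0.le, ← hS]
    rfl
  have hbound := hyper.bound hf.toLp (hfp.ae_eq hf.coeFn_toLp.symm) u hu t htT ht0
  rw [hnorm, ← ENNReal.ofReal_mul (hyper.A_nonneg t htT)] at hbound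
  have hexp : 1 ≤ q t / (q t - 1) := by rw [le_div_iff₀ hq1]; linarith
  have hpow : ∀ x, |oddPow p (f x)| ^ (q t / (q t - 1))
      = |f x| ^ ((p - 1) * (q t / (q t - 1))) := fun x => by
    rw [abs_oddPow hp, Real.rpow_mul (abs_nonneg _)]
  have hgm : AEStronglyMeasurable (fun x => oddPow p (f x)) volume :=
    ((measurable_oddPow p).comp_aemeasurable hf.1.aemeasurable).aestronglyMeasurable
  have hg : MemLp (fun x => oddPow p (f x)) (ENNReal.ofReal (q t / (q t - 1))) volume := by
    rw [← integrable_norm_rpow_iff hgm (by simp; linarith) ENNReal.ofReal_ne_top,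
      ENNReal.toReal_ofReal (by linarith)]
    simp_rw [Real.norm_eq_abs, hpow]
    exact integrable_abs_rpow_of_bounded hf1 hK (one_le_mul_of_one_le_of_one_le
      (by linarith) hexp)
  have key := integral_mul_le_of_eLpNorm_le (by linarith)
    (mul_nonneg (hyper.A_nonneg t htT) (Real.rpow_nonneg hS0.le _)) (Lp.aestronglyMeasurable _)
    hbound hg
  simp_rw [hpow] at key
  refine key.trans (le_of_eq ?_)
  change A t * S ^ p⁻¹ * m ((p - 1) * (q t / (q t - 1))) ^ (1 - 1 / q t)
    = A t * Real.exp (1 / p * Real.log S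
        + (1 - 1 / q t) * Real.log (m ((p - 1) * (q t / (q t - 1)))))
  rw [Real.exp_add, mul_assoc, Real.rpow_def_of_pos hS0, Real.rpow_def_of_pos hmt, ← one_div p,
    mul_comm (Real.log S), mul_comm (Real.log (m _))]

/-! ### Truncation and passage to the limit. -/

/-- Truncation at the levels `±K`. -/
def truncate (K s : ℝ) : ℝ := max (-K) (min K s)

lemma monotone_truncate (K : ℝ) : Monotone (truncate K) :=
  fun _ _ h => max_le_max le_rfl (min_le_min le_rfl h)

lemma truncate_sub_le {K a b : ℝ} (h : b ≤ a) : truncate K a - truncate K b ≤ a - b := by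
  unfold truncate
  rcases max_cases (-K) (min K a) with h1 | h1 <;> rcases max_cases (-K) (min K b) with h2 | h2 <;>
  rcases min_cases K a with h3 | h3 <;> rcases min_cases K b with h4 | h4 <;> linarith

lemma abs_truncate_sub_le (K a b : ℝ) : |truncate K a - truncate K b| ≤ |a - b| := by
  rcases le_total b a with h | h
  · rw [abs_of_nonneg (sub_nonneg.mpr (monotone_truncate K h)), abs_of_nonneg (sub_nonneg.mpr h)]
    exact truncate_sub_le h
  · rw [abs_sub_comm, abs_sub_comm a,
      abs_of_nonneg (sub_nonneg.mpr (monotone_truncate K h)), abs_of_nonneg (sub_nonneg.mpr h)]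
    exact truncate_sub_le h

lemma abs_truncate_le {K : ℝ} (hK : 0 ≤ K) (s : ℝ) : |truncate K s| ≤ K :=
  abs_le.mpr ⟨le_max_left _ _, max_le (by linarith) (min_le_left _ _)⟩

lemma truncate_of_abs_le {K s : ℝ} (h : |s| ≤ K) : truncate K s = s := by
  rw [abs_le] at h
  rw [truncate, min_eq_right h.2, max_eq_right h.1]

lemma abs_truncate_of_le {K s : ℝ} (hK : 0 ≤ K) (h : K ≤ |s|) : |truncate K s| = K := by
  rcases le_abs.mp h with h | h
  · rw [truncate, min_eq_left h, max_eq_right (by linarith), abs_of_nonneg hK]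
  · rw [truncate, min_eq_right (by linarith), max_eq_left (by linarith), abs_neg, abs_of_nonneg hK]

lemma abs_truncate_le_abs {K : ℝ} (hK : 0 ≤ K) (s : ℝ) : |truncate K s| ≤ |s| := by
  have h := abs_truncate_sub_le K s 0
  rwa [truncate_of_abs_le (s := 0) (by simpa using hK), sub_zero, sub_zero] at h

lemma continuous_truncate (K : ℝ) : Continuous (truncate K) := by
  unfold truncate
  fun_prop

/-- A monotone odd map commutes with `max` and `min`, so it carries truncation at `K` to truncation
at the image level. Hence both factors of the energy integrand contract. -/
lemma oddPow_truncate {p : ℝ} (hp : 2 ≤ p) (K s : ℝ) :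
    oddPow p (truncate K s) = truncate (oddPow p K) (oddPow p s) := by
  rw [truncate, (monotone_oddPow hp).map_max, (monotone_oddPow hp).map_min, oddPow_neg, truncate]

lemma oddPow_sub_mul_sub_nonneg {p : ℝ} (hp : 2 ≤ p) (a b : ℝ) :
    0 ≤ (oddPow p a - oddPow p b) * (a - b) := by
  rcases le_total b a with h | h
  · exact mul_nonneg (sub_nonneg.mpr (monotone_oddPow hp h)) (sub_nonneg.mpr h)
  · exact mul_nonneg_of_nonpos_of_nonpos (sub_nonpos.mpr (monotone_oddPow hp h))
      (sub_nonpos.mpr h)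

lemma oddPow_truncate_sub_mul_sub_le {p : ℝ} (hp : 2 ≤ p) (K a b : ℝ) :
    (oddPow p (truncate K a) - oddPow p (truncate K b)) * (truncate K a - truncate K b)
      ≤ (oddPow p a - oddPow p b) * (a - b) := by
  have h := abs_truncate_sub_le (oddPow p K) (oddPow p a) (oddPow p b)
  rw [← oddPow_truncate hp, ← oddPow_truncate hp] at h
  rw [← abs_of_nonneg (oddPow_sub_mul_sub_nonneg hp a b),
    ← abs_of_nonneg (oddPow_sub_mul_sub_nonneg hp (truncate K a) (truncate K b)), abs_mul, abs_mul]
  exact mul_le_mul h (abs_truncate_sub_le K a b) (abs_nonneg _) (abs_nonneg _)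

lemma dirichletForm_oddPow_integrand_nonneg {p : ℝ} (hp : 2 ≤ p) (f : RN N → ℝ)
    (z : RN N × RN N) :
    0 ≤ 1 / 2 * ((oddPow p (f z.1) - oddPow p (f z.2)) * (f z.1 - f z.2) * (J z.1 z.2 : ℝ)) :=
  mul_nonneg (by norm_num) (mul_nonneg (oddPow_sub_mul_sub_nonneg hp _ _) (J z.1 z.2).2)

lemma dirichletForm_oddPow_nonneg {p : ℝ} (hp : 2 ≤ p) (f : RN N → ℝ) :
    0 ≤ dirichletForm J (fun x => oddPow p (f x)) f := by
  rw [dirichletForm, extIntegral_of_nonneg (dirichletForm_oddPow_integrand_nonneg hp f)]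
  exact EReal.coe_ennreal_nonneg _

lemma dirichletForm_truncate_le {p : ℝ} (hp : 2 ≤ p) (f : RN N → ℝ) (K : ℝ) :
    dirichletForm J (fun x => oddPow p (truncate K (f x))) (fun x => truncate K (f x))
      ≤ dirichletForm J (fun x => oddPow p (f x)) f := by
  rw [dirichletForm, dirichletForm,
    extIntegral_of_nonneg (dirichletForm_oddPow_integrand_nonneg hp f),
    extIntegral_of_nonneg (dirichletForm_oddPow_integrand_nonneg hp fun x => truncate K (f x)),
    EReal.coe_ennreal_le_coe_ennreal_iff]
  refine lintegral_mono fun z => ENNReal.ofReal_le_ofReal ?_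
  refine mul_le_mul_of_nonneg_left ?_ (by norm_num)
  exact mul_le_mul_of_nonneg_right (oddPow_truncate_sub_mul_sub_le hp K _ _) (J z.1 z.2).2

/-- A version of Fatou's lemma for approximations that have the negative part of the limit. -/
lemma extIntegral_le_of_tendsto {α : Type*} [MeasurableSpace α] {μ : Measure α} {F : α → ℝ}
    {G : ℕ → α → ℝ} {c : ℕ → ℝ} {M : ℝ} (hint : ∀ n, Integrable (G n) μ)
    (hlim : ∀ x, ∀ᶠ n in atTop, G n x = F x)
    (hneg : ∀ n x, ENNReal.ofReal (-(G n x)) = ENNReal.ofReal (-(F x)))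
    (hc : Tendsto c atTop (𝓝 M)) (hle : ∀ᶠ n in atTop, ∫ x, G n x ∂μ ≤ c n) :
    extIntegral μ F ≤ (M : EReal) := by
  set P := ∫⁻ x, ENNReal.ofReal (F x) ∂μ with hP
  set Q := ∫⁻ x, ENNReal.ofReal (-(F x)) ∂μ with hQ
  have hQn : ∀ n, ∫⁻ x, ENNReal.ofReal (-(G n x)) ∂μ = Q := fun n => by simp_rw [hneg]; rfl
  have hQtop : Q ≠ ∞ := by
    rw [← hQn 0]
    exact (hint 0).neg.lintegral_lt_top.ne
  -- All approximations share the finite negative part `Q`, so bounds on the integrals become bounds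
  -- on the positive parts, to which Fatou's lemma applies.
  have hpos : ∀ᶠ n in atTop, (∫⁻ x, ENNReal.ofReal (G n x) ∂μ).toReal ≤ c n + Q.toReal := by
    filter_upwards [hle] with n hn
    rw [integral_eq_lintegral_pos_part_sub_lintegral_neg_part (hint n), hQn] at hn
    linarith
  have hc' : Tendsto (fun n => c n + Q.toReal) atTop (𝓝 (M + Q.toReal)) := hc.add_const _
  have hMQ : 0 ≤ M + Q.toReal := by
    refine ge_of_tendsto hc' ?_
    filter_upwards [hpos] with n hn
    exact ENNReal.toReal_nonneg.trans hn
  have hPle : P ≤ ENNReal.ofReal (M + Q.toReal) := by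
    calc P = ∫⁻ x, liminf (fun n => ENNReal.ofReal (G n x)) atTop ∂μ := by
          refine lintegral_congr fun x => ?_
          have : Tendsto (fun n => ENNReal.ofReal (G n x)) atTop (𝓝 (ENNReal.ofReal (F x))) :=
            tendsto_const_nhds.congr' ((hlim x).mono fun n hn => by simp only [hn])
          exact this.liminf_eq.symm
      _ ≤ liminf (fun n => ∫⁻ x, ENNReal.ofReal (G n x) ∂μ) atTop :=
          lintegral_liminf_le' fun n => (hint n).1.aemeasurable.ennreal_ofReal
      _ ≤ liminf (fun n => ENNReal.ofReal (c n + Q.toReal)) atTop := by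
          refine liminf_le_liminf ?_
          filter_upwards [hpos] with n hn
          rw [← ENNReal.ofReal_toReal (hint n).lintegral_lt_top.ne]
          exact ENNReal.ofReal_le_ofReal hn
      _ = ENNReal.ofReal (M + Q.toReal) := (ENNReal.tendsto_ofReal hc').liminf_eq
  have hPtop : P ≠ ∞ := (hPle.trans_lt ENNReal.ofReal_lt_top).ne
  have hPreal : P.toReal ≤ M + Q.toReal := ENNReal.toReal_le_of_le_ofReal hMQ hPle
  rw [extIntegral, ← hP, ← hQ, ← EReal.coe_ennreal_toReal hPtop, ← EReal.coe_ennreal_toReal hQtop,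
    ← EReal.coe_sub, EReal.coe_le_coe_iff]
  linarith

lemma Phi_abs_rpow (p s : ℝ) (hp : p ≠ 0) : Phi (|s| ^ p) = p * (|s| ^ p * Real.log |s|) := by
  rcases (abs_nonneg s).eq_or_lt with h | h
  · rw [← h, Real.zero_rpow hp, Phi, Real.log_zero]; simp
  · rw [Phi, Real.log_rpow h]; ring

/-- `Φ` is negative only on `(0, 1)`, and truncation at a level `K ≥ 1` leaves values below `1`
unchanged. -/
lemma ofReal_neg_Phi_truncate {p K s : ℝ} (hp : 0 < p) (hK : 1 ≤ K) :
    ENNReal.ofReal (-(Phi (|truncate K s| ^ p))) = ENNReal.ofReal (-(Phi (|s| ^ p))) := by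
  rcases le_total |s| K with h | h
  · rw [truncate_of_abs_le h]
  · have hnn : ∀ a : ℝ, 1 ≤ a → ENNReal.ofReal (-(Phi a)) = 0 := fun a ha =>
      ENNReal.ofReal_of_nonpos (neg_nonpos.mpr (mul_nonneg (by linarith) (Real.log_nonneg ha)))
    rw [abs_truncate_of_le (by linarith) h, hnn _ (Real.one_le_rpow hK hp.le),
      hnn _ (Real.one_le_rpow (hK.trans h) hp.le)]

lemma eventually_truncate_eq (s : ℝ) : ∀ᶠ n : ℕ in atTop, truncate (n + 1) s = s := by
  filter_upwards [eventually_ge_atTop ⌈|s|⌉₊] with n hn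
  refine truncate_of_abs_le ?_
  have := Nat.ceil_le.mp hn
  linarith

lemma eLpNorm_rpow_eq_ofReal_integral {α : Type*} [MeasurableSpace α] {μ : Measure α} {f : α → ℝ}
    {p : ℝ} (hp : 0 < p) (hf : MemLp f (ENNReal.ofReal p) μ) :
    eLpNorm f (ENNReal.ofReal p) μ ^ p = ENNReal.ofReal (∫ x, |f x| ^ p ∂μ) := by
  have hS : 0 ≤ ∫ x, |f x| ^ p ∂μ := integral_nonneg fun x => Real.rpow_nonneg (abs_nonneg _) _
  rw [hf.eLpNorm_eq_integral_rpow_norm (by simpa using hp) ENNReal.ofReal_ne_top,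
    ENNReal.toReal_ofReal hp.le, ENNReal.ofReal_rpow_of_nonneg (Real.rpow_nonneg
      (integral_nonneg fun x => Real.rpow_nonneg (norm_nonneg _) _) _) hp.le]
  simp_rw [Real.norm_eq_abs]
  rw [← Real.rpow_mul hS, inv_mul_cancel₀ hp.ne', Real.rpow_one]

lemma entropy_abs_rpow_of_ae_eq_zero {f : RN N → ℝ} {p : ℝ} (hp : p ≠ 0)
    (h : f =ᵐ[volume] 0) : entropy (fun x => |f x| ^ p) = 0 := by
  have h1 : ∫ x, |(|f x| ^ p)| = 0 := by
    refine integral_eq_zero_of_ae ?_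
    filter_upwards [h] with x hx
    simp [hx, Real.zero_rpow hp]
  have h2 : ∀ σ : ℝ → ℝ, σ 0 = 0 → ∫⁻ x, ENNReal.ofReal (σ (Phi |(|f x| ^ p)|)) = 0 := by
    intro σ hσ
    refine (lintegral_congr_ae (g := fun _ => 0) ?_).trans lintegral_zero
    filter_upwards [h] with x hx
    simp [hx, Real.zero_rpow hp, Phi, hσ]
  rw [entropy, h1, extIntegral, h2 (fun s => s) rfl, h2 (fun s => -s) neg_zero]
  simp [Phi]

end LevyHyper

end

/-! ### The entropy inequality. -/

open LevyHyper in
theorem mainTheorem1 {N : ℕ} (J : LevyHyper.RN N → LevyHyper.RN N → ℝ≥0)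
    (hJ : LevyHyper.IsLevyKernel J)
    (p : ℝ) (hp : 2 ≤ p) (T : EReal) (q A : ℝ → ℝ)
    (hyper : LevyHyper.IsHypercontractive J p T q A)
    (hq : ContDiffOn ℝ 1 q (LevyHyper.timeDomain T))
    (hq' : 0 < derivWithin q (Set.Ici 0) 0)
    (hA0 : A 0 = 1) (hA : Tendsto A (𝓝[>] 0) (𝓝 1))
    (A' : EReal)
    (hA' : Tendsto (fun h : ℝ => (((A h - 1) / h : ℝ) : EReal)) (𝓝[>] 0) (𝓝 A'))
    (hA'_lt : A' < ⊤)
    (f : LevyHyper.RN N → ℝ) (hf1 : MemLp f 1 volume)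
    (hfp : MemLp f (ENNReal.ofReal p) volume) (hf : LevyHyper.InHL J f) :
    LevyHyper.entropy (fun x => |f x| ^ p)
      ≤ ((p ^ 2 / derivWithin q (Set.Ici 0) 0 : ℝ) : EReal) * A'
          * ((eLpNorm f (ENNReal.ofReal p) volume ^ p : ℝ≥0∞) : EReal)
        + ((p ^ 2 / derivWithin q (Set.Ici 0) 0 : ℝ) : EReal)
          * LevyHyper.dirichletForm J (fun x => |f x| ^ (p - 2) * f x) f := by
  have hp0 : 0 < p := by linarith
  set d := derivWithin q (Set.Ici 0) 0 with hd
  have hc0 : 0 < p ^ 2 / d := by positivity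
  obtain ⟨hf2, hdf⟩ := (inHL_iff hJ).mp hf
  have hE0 := dirichletForm_oddPow_nonneg (J := J) hp f
  have hEmono := fun n : ℕ => dirichletForm_truncate_le (J := J) hp f (n + 1)
  change _ ≤ _ + _ * dirichletForm J (fun x => oddPow p (f x)) f
  rw [eLpNorm_rpow_eq_ofReal_integral hp0 hfp]
  set S := ∫ x, |f x| ^ p with hS
  have hSnn : 0 ≤ S := integral_nonneg fun x => Real.rpow_nonneg (abs_nonneg _) _
  have hintp : Integrable (fun x => |f x| ^ p) := by
    have := (integrable_norm_rpow_iff hfp.1 (by simpa using hp0) ENNReal.ofReal_ne_top).mpr hfp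
    rwa [ENNReal.toReal_ofReal hp0.le] at this
  -- If `S = 0`, then `f = 0` almost everywhere and the entropy vanishes; the term with `A'` is `0`
  -- even for `A' = -∞`.
  rcases hSnn.eq_or_lt with hS0 | hS0
  · have hf0 : f =ᵐ[volume] 0 := by
      have := (integral_eq_zero_iff_of_nonneg
        (fun x => Real.rpow_nonneg (abs_nonneg (f x)) p) hintp).mp hS0.symm
      filter_upwards [this] with x hx
      exact abs_eq_zero.mp ((Real.rpow_eq_zero (abs_nonneg _) hp0.ne').mp hx)
    rw [entropy_abs_rpow_of_ae_eq_zero hp0.ne' hf0, ← hS0, ENNReal.ofReal_zero,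
      EReal.coe_ennreal_zero, mul_zero, zero_add]
    exact mul_nonneg (EReal.coe_nonneg.mpr hc0.le) hE0
  have hK : ∀ n : ℕ, (0 : ℝ) ≤ n + 1 := fun n => by positivity
  have hbd : ∀ (n : ℕ) x, |truncate (n + 1) (f x)| ≤ n + 1 := fun n x => abs_truncate_le (hK n) _
  have hm : ∀ n : ℕ, AEStronglyMeasurable (fun x => truncate (n + 1) (f x)) volume := fun n =>
    (continuous_truncate _).comp_aestronglyMeasurable hf2.1
  have hn1 : ∀ n : ℕ, Integrable fun x => truncate (n + 1) (f x) := fun n =>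
    (memLp_one_iff_integrable.mp hf1).mono (hm n)
      (Eventually.of_forall fun x => abs_truncate_le_abs (hK n) _)
  have hn2 : ∀ n : ℕ, MemLp (fun x => truncate (n + 1) (f x)) 2 volume := fun n =>
    hf2.mono (hm n) (Eventually.of_forall fun x => abs_truncate_le_abs (hK n) _)
  have hnd : ∀ n : ℕ, MemLp (diff fun x => truncate (n + 1) (f x)) 2 (jumpMeasure J) := fun n =>
    hdf.mono (aestronglyMeasurable_diff (hm n))
      (Eventually.of_forall fun z => abs_truncate_sub_le _ _ _)
  have hStend : Tendsto (fun n : ℕ => ∫ x, |truncate (n + 1) (f x)| ^ p) atTop (𝓝 S) := by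
    refine tendsto_integral_of_dominated_convergence (fun x => |f x| ^ p)
      (fun n => ((hm n).aemeasurable.abs.pow_const p).aestronglyMeasurable) hintp
      (fun n => Eventually.of_forall fun x => ?_) (Eventually.of_forall fun x => ?_)
    · rw [Real.norm_of_nonneg (by positivity)]
      exact Real.rpow_le_rpow (abs_nonneg _) (abs_truncate_le_abs (hK n) _) hp0.le
    · exact tendsto_const_nhds.congr'
        ((eventually_truncate_eq (f x)).mono fun n hn => by simp only [hn])
  have hSpos := hStend.eventually (lt_mem_nhds hS0)
  have hmain := fun (n : ℕ) hpos => le_deriv_of_bounded hJ hp hyper hq' hA' (hbd n) (hn1 n) (hn2 n)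
    (hnd n) rfl hpos
  -- A truncation of `f` with nonzero `L^p` norm bounds `A'` below by a real number, which excludes
  -- `A' = -∞`.
  lift A' to ℝ using ⟨hA'_lt.ne, fun h => by
    obtain ⟨n, hn⟩ := hSpos.exists
    have := hmain n hn
    rw [h, le_bot_iff] at this
    exact EReal.coe_ne_bot _ this⟩ with a
  rw [EReal.coe_ennreal_ofReal, max_eq_left hSnn]
  rcases eq_or_ne (dirichletForm J (fun x => oddPow p (f x)) f) ⊤ with htop | htop
  · rw [htop, EReal.coe_mul_top_of_pos hc0, ← EReal.coe_mul, ← EReal.coe_mul, EReal.coe_add_top]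
    exact le_top
  lift dirichletForm J (fun x => oddPow p (f x)) f to ℝ using
    ⟨htop, (EReal.bot_lt_zero.trans_le hE0).ne'⟩ with e
  have hphi : ∀ n : ℕ, ∀ x, Phi (|truncate (n + 1) (f x)| ^ p)
      = p * (|truncate (n + 1) (f x)| ^ p * Real.log |truncate (n + 1) (f x)|) :=
    fun n x => Phi_abs_rpow _ _ hp0.ne'
  have hlimit : extIntegral volume (fun x => Phi (|f x| ^ p))
      ≤ ((p ^ 2 / d * (a * S + e) + S * Real.log S : ℝ) : EReal) := by
    refine extIntegral_le_of_tendsto (G := fun (n : ℕ) x => Phi (|truncate (n + 1) (f x)| ^ p))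
      (c := fun n : ℕ => p ^ 2 / d * (a * (∫ x, |truncate (n + 1) (f x)| ^ p) + e)
        + (∫ x, |truncate (n + 1) (f x)| ^ p) * Real.log (∫ x, |truncate (n + 1) (f x)| ^ p))
      (fun n => ?_) (fun x => (eventually_truncate_eq (f x)).mono fun n hn => by simp only [hn])
      (fun n x => ofReal_neg_Phi_truncate hp0 (by simp)) ?_ ?_
    · simp_rw [hphi]
      exact (integrable_abs_rpow_mul_log_of_bounded (hn1 n) (hbd n) (by linarith)).const_mul p
    · exact (((hStend.const_mul a).add_const e).const_mul _).add
        (hStend.mul (hStend.log hS0.ne'))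
    · filter_upwards [hSpos] with n hn
      have h1 := EReal.coe_le_coe_iff.mp (hmain n hn)
      have h2 := hEmono n
      rw [dirichletForm_eq_integral hJ (memLp_diff_oddPow hp (hm n) (hnd n) (hbd n)) (hnd n),
        EReal.coe_le_coe_iff] at h2
      simp_rw [mul_comm (diff (fun x => oddPow p (truncate (n + 1) (f x))) _)] at h2
      simp_rw [hphi]
      rw [integral_const_mul]
      set s := ∫ x, |truncate (n + 1) (f x)| ^ p
      set E := ∫ z, diff (fun x => truncate (n + 1) (f x)) z
        * diff (fun x => oddPow p (truncate (n + 1) (f x))) z ∂jumpMeasure J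
      set Lam := ∫ x, |truncate (n + 1) (f x)| ^ p * Real.log |truncate (n + 1) (f x)|
      -- Multiplying by `s` and using `E ≤ e` leaves an inequality whose left side is `d/p²` times
      -- the entropy of the truncated function.
      rw [← sub_div, div_le_iff₀ hn] at h1
      have h3 : d / p ^ 2 * (p * Lam - s * Real.log s) ≤ a * s + e := by
        have : d / p ^ 2 * (p * Lam) = d / p * Lam := by field_simp
        rw [mul_sub, this]
        linarith
      have h4 : p * Lam - s * Real.log s ≤ p ^ 2 / d * (a * s + e) := by
        calc p * Lam - s * Real.log s
            = p ^ 2 / d * (d / p ^ 2 * (p * Lam - s * Real.log s)) := by field_simp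
          _ ≤ _ := mul_le_mul_of_nonneg_left h3 hc0.le
      linarith
  have habs : ∀ x, |(|f x| ^ p)| = |f x| ^ p := fun x =>
    abs_of_nonneg (Real.rpow_nonneg (abs_nonneg _) _)
  rw [entropy]
  simp_rw [habs]
  rw [← hS, ← EReal.coe_mul, ← EReal.coe_mul, ← EReal.coe_mul, ← EReal.coe_add]
  -- `Φ(S)` is finite, so it can be moved to the right side.
  refine EReal.sub_le_of_le_add ?_
  rw [← EReal.coe_add]
  refine hlimit.trans (le_of_eq ?_)
  rw [Phi]
  congr 1
  ring
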